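/- **Conventions.** Let $B_n$ be the braid group on $n$ strands with Artin generators $\sigma_1,\dots,\sigma_{n-1}$, let $\omega(\beta)$ be the exponent sum of $\beta\in B_n$, and let $\hat\beta$ be its closure. Let $\mathcal A_n$ be the free noncommutative unital ring generated by $a_{ij}$, $1\le i\ne j\le n$, and let $\phi\colon B_n\to\operatorname{Aut}\mathcal A_n$ be the homomorphism (products in $\operatorname{Aut}\mathcal A_n$ are compositions) such that $\phi_{\sigma_m}$ maps, for $i,j\ne m,m+1$, $$a_{ij}\mapsto a_{ij},\quad a_{m+1,i}\mapsto a_{mi},\quad a_{i,m+1}\mapsto a_{im},\quad a_{m,m+1}\mapsto -a_{m+1,m},\quad a_{m+1,m}\mapsto -a_{m,m+1},$$ $$a_{mi}\mapsto a_{m+1,i}-a_{m+1,m}a_{mi},\qquad a_{im}\mapsto a_{i,m+1}-a_{im}a_{m,m+1}.$$ Regard $\beta\in B_n$ as an element of $B_{n+1}$ via $\sigma_i\mapsto\sigma_i$, let $\phi^*_\beta\in\operatorname{Aut}\mathcal A_{n+1}$ be the resulting automorphism, and define $n\times n$ matrices $\Phi^L_\beta,\Phi^R_\beta$ over $\mathcal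 A_n$ by $$\phi^*_\beta(a_{i,n+1})=\sum_{j=1}^n(\Phi^L_\beta)_{ij}\,a_{j,n+1},\qquad \phi^*_\beta(a_{n+1,i})=\sum_{j=1}^n a_{n+1,j}\,(\Phi^R_\beta)_{ji}.$$ Let $R_0=\mathbb Z[\lambda^{\pm1},\mu^{\pm1}]$, let $\mathbf A$ be the $n\times n$ matrix over $\mathcal A_n\otimes R_0$ with entries $a_{ij}$ for $i<j$, $-\mu a_{ij}$ for $i>j$, and $1-\mu$ for $i=j$, and let $\mathbf\Lambda=\operatorname{diag}[\lambda\mu^{\omega(\beta)},1,\dots,1]$. An *augmentation* of the knot $\hat\beta$ is a unital ring homomorphism $\epsilon\colon\mathcal A_n\otimes R_0\to\mathbb C$ that vanishes on the two-sided ideal generated by the entries of $\mathbf A-\mathbf\Lambda\Phi^L_\beta\mathbf A$ and $\mathbf A-\mathbf A\Phi^R_\beta\mathbf\Lambda^{-1}$. If $\epsilon(\mu)\ne1$, its *rank* is the rank of the complex matrix $\epsilon(\mathbf A)$. The *augmentation rank* $\operatorname{ar}(\hat\beta)$ is the maximal rank of an augmentation $\epsilon$ of $\hat\beta$ with $\epsilon(\mu)\neq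 1$. For $\alpha\in B_k$ and $\gamma\in B_p$, let ${}^{p}\alpha\in B_{kp}$ be the braid obtained by replacing each strand of $\alpha$ by $p$ parallel copies in the blackboard framing (so each crossing of two strands becomes the $p^2$ crossings of two blocks of $p$ strands, of the same sign, with no crossing inside a block), and let $\bar\gamma\in B_{kp}$ be the image of $\gamma$ under $\sigma_i\mapsto\sigma_i$, $1\le i\le p-1$. The *braid satellite* $K(\alpha,\gamma)$ is the closure of ${}^{p}\alpha\,\bar\gamma$. **Theorem.** Let $\alpha\in B_k$ and $\gamma\in B_p$ be braids whose closures $\hat\alpha$ and $\hat\gamma$ are knots. If $\operatorname{ar}(\hat\alpha)=k$ and $\operatorname{ar}(\hat\gamma)=p$, then $$\operatorname{ar}(K(\alpha,\gamma))=kp.$$ -/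

import Mathlib

open scoped TensorProduct

namespace BraidSatellite

/-! ### Braid groups -/

/-- Indices of the Artin generators of the braid group on `n` strands. Strands are numbered
`0, …, n - 1`, and the generator with index `i` involves the strands `i` and `i + 1`. -/
abbrev BraidGen (n : ℕ) : Type := {i : ℕ // i + 1 < n}

/-- Artin's relations. -/
def braidRels (n : ℕ) : Set (FreeGroup (BraidGen n)) :=
  {w | ∃ i j : BraidGen n, (i : ℕ) + 1 < j ∧
    w = FreeGroup.of i * FreeGroup.of j * (FreeGroup.of j * FreeGroup.of i)⁻¹} ∪
  {w | ∃ i j : BraidGen n, (i : ℕ) + 1 = j ∧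
    w = FreeGroup.of i * FreeGroup.of j * FreeGroup.of i *
      (FreeGroup.of j * FreeGroup.of i * FreeGroup.of j)⁻¹}

/-- The braid group `B_n`, by Artin's presentation. -/
abbrev BraidGroup (n : ℕ) : Type := PresentedGroup (braidRels n)

/-- Homomorphisms out of `B_n` from the images of the Artin generators. -/
def braidLift {n : ℕ} {G : Type*} [Group G] (f : BraidGen n → G)
    (hcomm : ∀ i j : BraidGen n, (i : ℕ) + 1 < j → f i * f j = f j * f i)
    (hbraid : ∀ i j : BraidGen n, (i : ℕ) + 1 = j → f i * f j * f i = f j * f i * f j) :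
    BraidGroup n →* G :=
  PresentedGroup.toGroup (f := f) (by
    rintro w (⟨i, j, h, rfl⟩ | ⟨i, j, h, rfl⟩)
    · simp only [map_mul, map_inv, FreeGroup.lift_apply_of]
      rw [hcomm i j h, mul_inv_cancel]
    · simp only [map_mul, map_inv, FreeGroup.lift_apply_of]
      rw [hbraid i j h, mul_inv_cancel])

@[simp]
theorem braidLift_of {n : ℕ} {G : Type*} [Group G] (f : BraidGen n → G) (hcomm) (hbraid)
    (i : BraidGen n) : braidLift f hcomm hbraid (PresentedGroup.of i) = f i :=
  PresentedGroup.toGroup.of _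

/-- The Artin generator crossing the strands `i` and `i + 1`. (Only used for `i + 1 < n`.) -/
def sigma (n i : ℕ) : BraidGroup n :=
  if h : i + 1 < n then PresentedGroup.of ⟨i, h⟩ else 1

theorem sigma_comm {n i j : ℕ} (h : i + 1 < j) (hj : j + 1 < n) :
    sigma n i * sigma n j = sigma n j * sigma n i := by
  have hi : i + 1 < n := by omega
  simp only [sigma, hi, hj, dif_pos]
  have := PresentedGroup.one_of_mem (rels := braidRels n)
    (Or.inl ⟨⟨i, hi⟩, ⟨j, hj⟩, h, rfl⟩)
  rw [map_mul, map_inv, mul_inv_eq_one] at this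
  simpa [PresentedGroup.of] using this

theorem sigma_braid {n i : ℕ} (h : i + 1 + 1 < n) :
    sigma n i * sigma n (i + 1) * sigma n i =
      sigma n (i + 1) * sigma n i * sigma n (i + 1) := by
  have hi : i + 1 < n := by omega
  simp only [sigma, hi, h, dif_pos]
  have := PresentedGroup.one_of_mem (rels := braidRels n)
    (Or.inr ⟨⟨i, hi⟩, ⟨i + 1, h⟩, rfl, rfl⟩)
  rw [map_mul, map_inv, mul_inv_eq_one] at this
  simpa [PresentedGroup.of] using this

/-- The inclusion `B_n → B_m` for `n ≤ m`, sending each Artin generator to the one with the same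
index. -/
def braidIncl {n m : ℕ} (h : n ≤ m) : BraidGroup n →* BraidGroup m :=
  braidLift (fun i => sigma m i)
    (fun i j hij => sigma_comm hij (by have := j.2; omega))
    (fun i j hij => by rw [← hij]; exact sigma_braid (by have := j.2; omega))

/-- The writhe (algebraic length), i.e. the exponent sum in the Artin generators. -/
def writheHom (n : ℕ) : BraidGroup n →* Multiplicative ℤ :=
  braidLift (fun _ => Multiplicative.ofAdd 1) (fun _ _ _ => rfl) (fun _ _ _ => rfl)

/-- The writhe `ω(β)` as an integer. -/
def writhe {n : ℕ} (β : BraidGroup n) : ℤ := Multiplicative.toAdd (writheHom n β)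

theorem swap_braid {X : Type*} [DecidableEq X] {a b c : X} (hab : a ≠ b) (hbc : b ≠ c)
    (hac : a ≠ c) : Equiv.swap a b * Equiv.swap b c * Equiv.swap a b =
      Equiv.swap b c * Equiv.swap a b * Equiv.swap b c := by
  rw [Equiv.swap_mul_swap_mul_swap hab hac, Equiv.swap_comm a b, Equiv.swap_comm b c,
    Equiv.swap_mul_swap_mul_swap hbc.symm hac.symm, Equiv.swap_comm]

/-- The homomorphism from `B_n` to the symmetric group on the strands. -/
def braidPerm (n : ℕ) : BraidGroup n →* Equiv.Perm (Fin n) :=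
  braidLift
    (fun i => Equiv.swap ⟨i, Nat.lt_of_succ_lt i.2⟩ ⟨i + 1, i.2⟩)
    (fun i j hij => by
      apply Equiv.Perm.Disjoint.commute
      intro x
      rcases eq_or_ne (x : ℕ) i with h | h
      · right
        apply Equiv.swap_apply_of_ne_of_ne <;> (intro e; simp [Fin.ext_iff] at e; omega)
      · rcases eq_or_ne (x : ℕ) (i + 1) with h' | h'
        · right
          apply Equiv.swap_apply_of_ne_of_ne <;> (intro e; simp [Fin.ext_iff] at e; omega)
        · left
          apply Equiv.swap_apply_of_ne_of_ne <;> (intro e; simp [Fin.ext_iff] at e; omega))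
    (fun i j hij => by
      obtain ⟨j, hj⟩ := j
      simp only at hij
      subst hij
      have h1 : (⟨i, Nat.lt_of_succ_lt i.2⟩ : Fin n) ≠ ⟨i + 1, i.2⟩ := by simp
      have h2 : (⟨i, Nat.lt_of_succ_lt i.2⟩ : Fin n) ≠ ⟨i + 1 + 1, hj⟩ := by
        simp [Fin.ext_iff]; omega
      have h3 : (⟨i + 1, i.2⟩ : Fin n) ≠ ⟨i + 1 + 1, hj⟩ := by simp
      exact swap_braid h1 h3 h2)

/-- The closure of `β` is a knot: it has exactly one component. The components of a braid closure
correspond to the orbits of the permutation of the strands. -/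
def ClosureIsKnot {n : ℕ} (β : BraidGroup n) : Prop :=
  0 < n ∧ (braidPerm n β).IsCycleOn Set.univ

/-! ### Parallels of braids and braid satellites -/

/-- `s m * s (m + 1) * ⋯ * s (m + l - 1)`. -/
def run {G : Type*} [Group G] (s : ℕ → G) (m : ℕ) : ℕ → G
  | 0 => 1
  | l + 1 => run s m l * s (m + l)

/-- `run (m + a - 1) l * ⋯ * run (m + 1) l * run m l`: with Artin generators for `s`, the block
of the `a` strands `m, …, m + a - 1` crosses the block of the `l` strands
`m + a, …, m + a + l - 1`, all crossings being positive and without any crossing inside a block. -/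
def blockCross {G : Type*} [Group G] (s : ℕ → G) (m l : ℕ) : ℕ → G
  | 0 => 1
  | a + 1 => run s (m + a) l * blockCross s m l a

section block

variable {G : Type*} [Group G] {s : ℕ → G} {N : ℕ}

theorem commute_run (x : G) (m l : ℕ) (h : ∀ t, m ≤ t → t < m + l → Commute x (s t)) :
    Commute x (run s m l) := by
  induction l with
  | zero => exact Commute.one_right x
  | succ l ih =>
    exact (ih fun t h1 h2 => h t h1 (by omega)).mul_right (h _ (by omega) (by omega))

theorem commute_blockCross (x : G) (m l a : ℕ)
    (h : ∀ t, m ≤ t → t + 1 < m + a + l → Commute x (s t)) :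
    Commute x (blockCross s m l a) := by
  induction a with
  | zero => exact Commute.one_right x
  | succ a ih =>
    exact (commute_run x _ _ fun t h1 h2 => h t (by omega) (by omega)).mul_right
      (ih fun t h1 h2 => h t h1 (by omega))

theorem run_add (m l l' : ℕ) : run s m (l + l') = run s m l * run s (m + l) l' := by
  induction l' with
  | zero => simp [run]
  | succ l' ih => rw [← add_assoc, run, run, ih, mul_assoc, add_assoc]

theorem semiconj_run (hc : ∀ i j, i + 1 < j → j + 1 < N → Commute (s i) (s j))
    (hb : ∀ i, i + 1 + 1 < N → s i * s (i + 1) * s i = s (i + 1) * s i * s (i + 1))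
    (m l i : ℕ) (h1 : m ≤ i) (h2 : i + 1 < m + l) (hN : m + l < N) :
    SemiconjBy (run s m l) (s i) (s (i + 1)) := by
  obtain ⟨d, rfl⟩ := Nat.exists_eq_add_of_le h1
  obtain ⟨e, rfl⟩ : ∃ e, l = d + 2 + e := ⟨l - (d + 2), by omega⟩
  rw [run_add m (d + 2) e]
  have A : SemiconjBy (run s m (d + 2)) (s (m + d)) (s (m + d + 1)) := by
    have h := hb (m + d) (by omega)
    have c : Commute (run s m d) (s (m + d + 1)) :=
      (commute_run _ _ _ fun t _ _ => (hc _ _ (by omega) (by omega)).symm).symm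
    change run s m d * s (m + d) * s (m + d + 1) * s (m + d) =
      s (m + d + 1) * (run s m d * s (m + d) * s (m + d + 1))
    calc _ = run s m d * (s (m + d) * s (m + d + 1) * s (m + d)) := by simp only [mul_assoc]
      _ = (run s m d * s (m + d + 1)) * (s (m + d) * s (m + d + 1)) := by
        rw [h]; simp only [mul_assoc]
      _ = _ := by rw [c.eq]; simp only [mul_assoc]
  have B : Commute (s (m + d)) (run s (m + (d + 2)) e) :=
    commute_run _ _ _ fun t _ _ => hc _ _ (by omega) (by omega)
  exact A.mul_left B.symm

theorem semiconj_blockCross (hc : ∀ i j, i + 1 < j → j + 1 < N → Commute (s i) (s j))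
    (hb : ∀ i, i + 1 + 1 < N → s i * s (i + 1) * s i = s (i + 1) * s i * s (i + 1))
    (m l a i : ℕ) (h1 : m ≤ i) (h2 : i + 1 < m + l) (hN : m + a + l ≤ N) :
    SemiconjBy (blockCross s m l a) (s i) (s (i + a)) := by
  induction a with
  | zero => exact SemiconjBy.one_left _
  | succ a ih =>
    exact (semiconj_run hc hb (m + a) l (i + a) (by omega) (by omega) (by omega)).mul_left
      (ih (by omega))

theorem blockCross_add (hc : ∀ i j, i + 1 < j → j + 1 < N → Commute (s i) (s j))
    (m l l' a : ℕ) (hN : m + a + l + l' ≤ N) :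
    blockCross s m (l + l') a = blockCross s m l a * blockCross s (m + l) l' a := by
  induction a with
  | zero => simp [blockCross]
  | succ a ih =>
    have c : Commute (run s (m + a + l) l') (blockCross s m l a) :=
      commute_blockCross _ _ _ _ fun t _ _ =>
        (commute_run _ _ _ fun u _ _ => hc _ _ (by omega) (by omega)).symm
    rw [blockCross, blockCross, blockCross, ih (by omega), run_add,
      show m + l + a = m + a + l by omega]
    calc _ = run s (m + a) l * (run s (m + a + l) l' * blockCross s m l a) *
          blockCross s (m + l) l' a := by simp only [mul_assoc]
      _ = _ := by rw [c.eq]; simp only [mul_assoc]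

theorem semiconj_run_of (x : G) (m l p : ℕ)
    (h : ∀ t, m ≤ t → t < m + l → SemiconjBy x (s t) (s (t + p))) :
    SemiconjBy x (run s m l) (run s (m + p) l) := by
  induction l with
  | zero => exact SemiconjBy.one_right x
  | succ l ih =>
    have := (ih fun t h1 h2 => h t h1 (by omega)).mul_right (h (m + l) (by omega) (by omega))
    rwa [show m + l + p = m + p + l by omega] at this

theorem semiconj_blockCross_of (x : G) (m l a p : ℕ)
    (h : ∀ t, m ≤ t → t + 1 < m + a + l → SemiconjBy x (s t) (s (t + p))) :
    SemiconjBy x (blockCross s m l a) (blockCross s (m + p) l a) := by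
  induction a with
  | zero => exact SemiconjBy.one_right x
  | succ a ih =>
    have := (semiconj_run_of x (m + a) l p fun t h1 h2 => h t (by omega) (by omega)).mul_right
      (ih fun t h1 h2 => h t h1 (by omega))
    rwa [show m + a + p = m + p + a by omega] at this

theorem blockCross_braid (hc : ∀ i j, i + 1 < j → j + 1 < N → Commute (s i) (s j))
    (hb : ∀ i, i + 1 + 1 < N → s i * s (i + 1) * s i = s (i + 1) * s i * s (i + 1))
    (m p : ℕ) (hN : m + p + p + p ≤ N) :
    blockCross s m p p * blockCross s (m + p) p p * blockCross s m p p =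
      blockCross s (m + p) p p * blockCross s m p p * blockCross s (m + p) p p := by
  have h := semiconj_blockCross_of (s := s) (blockCross s m (p + p) p) m p p p
    fun t h1 h2 => semiconj_blockCross hc hb m (p + p) p t h1 (by omega) (by omega)
  rw [blockCross_add hc m p p p (by omega)] at h
  simpa [SemiconjBy, mul_assoc] using h

theorem blockCross_comm (hc : ∀ i j, i + 1 < j → j + 1 < N → Commute (s i) (s j))
    (m m' p : ℕ) (h : m + p + p ≤ m') (hN : m' + p + p ≤ N) :
    Commute (blockCross s m p p) (blockCross s m' p p) :=
  commute_blockCross _ _ _ _ fun t _ _ =>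
    (commute_blockCross _ _ _ _ fun u _ _ => (hc _ _ (by omega) (by omega)).symm).symm

end block

/-- The `p`-parallel `B_k → B_{kp}` in the blackboard framing: strand `i` is replaced by the block
of strands `i p, …, i p + p - 1`, so that the crossing `σ_i` becomes the crossing of the blocks
`i` and `i + 1`. -/
def parallel (k p : ℕ) : BraidGroup k →* BraidGroup (k * p) :=
  braidLift (fun i => blockCross (sigma (k * p)) (i * p) p p)
    (fun i j hij => by
      have h1 : (i + 2) * p ≤ (j : ℕ) * p := Nat.mul_le_mul_right p (by omega)
      have h2 : ((j : ℕ) + 2) * p ≤ k * p := Nat.mul_le_mul_right p (by have := j.2; omega)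
      refine blockCross_comm (N := k * p) (fun _ _ h h' => sigma_comm h h') _ _ _ ?_ ?_
      · linarith
      · linarith)
    (fun i j hij => by
      have h2 : ((j : ℕ) + 2) * p ≤ k * p := Nat.mul_le_mul_right p (by have := j.2; omega)
      have h3 : (j : ℕ) * p = i * p + p := by rw [← hij]; ring
      rw [h3]
      refine blockCross_braid (N := k * p) (fun _ _ h h' => sigma_comm h h')
        (fun _ h => sigma_braid h) _ _ ?_
      linarith)

/-- The braid in `B_{kp}` whose closure is the braid satellite `K(α, γ)`: the `p`-parallel of `α`
followed by `γ` on the first `p` strands. -/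
def satelliteBraid {k p : ℕ} (hk : 0 < k) (α : BraidGroup k) (γ : BraidGroup p) :
    BraidGroup (k * p) :=
  parallel k p α * braidIncl (Nat.le_mul_of_pos_left p hk) γ

/-! ### The algebra `𝒜_n` and the action of the braid group -/

/-- The free noncommutative unital ring on generators `a_{ij}`, `i ≠ j`, for an index set `I`. -/
abbrev CordAlg (I : Type) : Type := FreeAlgebra ℤ {x : I × I // x.1 ≠ x.2}

theorem eq_cases_four {X : Type} (i s t u v : X) :
    i = s ∨ i = t ∨ i = u ∨ i = v ∨ (i ≠ s ∧ i ≠ t ∧ i ≠ u ∧ i ≠ v) := by tauto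

theorem eq_cases_three {X : Type} (i s t u : X) :
    i = s ∨ i = t ∨ i = u ∨ (i ≠ s ∧ i ≠ t ∧ i ≠ u) := by tauto

section action

variable {I : Type} [DecidableEq I]

/-- The generator `a_{ij}` for `i ≠ j` (and `0`, which is never used, for `i = j`). -/
def cord (i j : I) : CordAlg I :=
  if h : i ≠ j then FreeAlgebra.ι ℤ ⟨(i, j), h⟩ else 0

/-- The image of `a_{ij}` under the braid generator that exchanges the points `s` and `t`. -/
def crossFun (s t i j : I) : CordAlg I :=
  if i = s then
    if j = t then -cord t s else cord t j - cord t s * cord s j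
  else if i = t then
    if j = s then -cord s t else cord s j
  else if j = s then cord i t - cord i s * cord s t
  else if j = t then cord i s
  else cord i j

/-- The corresponding ring endomorphism. -/
def crossHom (s t : I) : CordAlg I →ₐ[ℤ] CordAlg I :=
  FreeAlgebra.lift ℤ fun x => crossFun s t x.1.1 x.1.2

theorem crossHom_cord (s t : I) {i j : I} (h : i ≠ j) :
    crossHom s t (cord i j) = crossFun s t i j := by
  simp [crossHom, cord, h]

theorem cordHom_ext {B : Type*} [Ring B] [Algebra ℤ B] {f g : CordAlg I →ₐ[ℤ] B}
    (h : ∀ i j, i ≠ j → f (cord i j) = g (cord i j)) : f = g := by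
  apply FreeAlgebra.hom_ext
  funext ⟨⟨i, j⟩, hij⟩
  have := h i j hij
  simpa [cord, show i ≠ j from hij] using this

theorem crossHom_comp_symm {s t : I} (h : s ≠ t) :
    (crossHom s t).comp (crossHom t s) = AlgHom.id ℤ _ := by
  apply cordHom_ext
  intro i j hij
  rw [AlgHom.comp_apply, crossHom_cord t s hij, AlgHom.id_apply]
  have h' := h.symm
  by_cases his : i = s <;> by_cases hit : i = t <;> by_cases hjs : j = s <;>
    by_cases hjt : j = t <;>
    simp_all [crossFun, crossHom_cord, eq_comm]

/-- The automorphism of `𝒜` by which the braid generator exchanging `s` and `t` acts. -/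
def crossEquiv (s t : I) (h : s ≠ t) : CordAlg I ≃ₐ[ℤ] CordAlg I :=
  AlgEquiv.ofAlgHom (crossHom s t) (crossHom t s)
    (crossHom_comp_symm h) (crossHom_comp_symm h.symm)

set_option linter.unusedSimpArgs false in
theorem crossHom_comm {s t u v : I} (hst : s ≠ t) (huv : u ≠ v) (hsu : s ≠ u) (hsv : s ≠ v)
    (htu : t ≠ u) (htv : t ≠ v) :
    (crossHom s t).comp (crossHom u v) = (crossHom u v).comp (crossHom s t) := by
  apply cordHom_ext
  intro i j hij
  rw [AlgHom.comp_apply, AlgHom.comp_apply, crossHom_cord _ _ hij, crossHom_cord _ _ hij]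
  have h1 := hst.symm
  have h2 := huv.symm
  have h3 := hsu.symm
  have h4 := hsv.symm
  have h5 := htu.symm
  have h6 := htv.symm
  have hji := hij.symm
  rcases eq_cases_four i s t u v with h | h | h | h | ⟨a1, a2, a3, a4⟩ <;>
  rcases eq_cases_four j s t u v with h' | h' | h' | h' | ⟨b1, b2, b3, b4⟩ <;>
  first
  | exact absurd (h.trans h'.symm) hij
  | (subst h; subst h'; simp [crossFun, crossHom_cord, *]; try noncomm_ring)
  | (subst h; simp [crossFun, crossHom_cord, *, Ne.symm b1, Ne.symm b2, Ne.symm b3, Ne.symm b4];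
     try noncomm_ring)
  | (subst h'; simp [crossFun, crossHom_cord, *, Ne.symm a1, Ne.symm a2, Ne.symm a3, Ne.symm a4];
     try noncomm_ring)
  | simp [crossFun, crossHom_cord, *]

set_option linter.unusedSimpArgs false in
theorem crossHom_braid {s t u : I} (hst : s ≠ t) (htu : t ≠ u) (hsu : s ≠ u) :
    ((crossHom s t).comp (crossHom t u)).comp (crossHom s t) =
      ((crossHom t u).comp (crossHom s t)).comp (crossHom t u) := by
  apply cordHom_ext
  intro i j hij
  simp only [AlgHom.comp_apply]
  rw [crossHom_cord _ _ hij, crossHom_cord _ _ hij]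
  have h1 := hst.symm
  have h2 := htu.symm
  have h3 := hsu.symm
  have hji := hij.symm
  rcases eq_cases_three i s t u with h | h | h | ⟨a1, a2, a3⟩ <;>
  rcases eq_cases_three j s t u with h' | h' | h' | ⟨b1, b2, b3⟩ <;>
  first
  | exact absurd (h.trans h'.symm) hij
  | (subst h; subst h'; simp [crossFun, crossHom_cord, *]; try noncomm_ring)
  | (subst h; simp [crossFun, crossHom_cord, *, Ne.symm b1, Ne.symm b2, Ne.symm b3];
     try noncomm_ring)
  | (subst h'; simp [crossFun, crossHom_cord, *, Ne.symm a1, Ne.symm a2, Ne.symm a3];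
     try noncomm_ring)
  | simp [crossFun, crossHom_cord, *]

end action

/-- The action `φ : B_n → Aut 𝒜_n`; multiplication in `Aut 𝒜_n` is composition of maps. -/
def phi (n : ℕ) : BraidGroup n →* (CordAlg (Fin n) ≃ₐ[ℤ] CordAlg (Fin n)) :=
  braidLift
    (fun i => crossEquiv ⟨i, Nat.lt_of_succ_lt i.2⟩ ⟨i + 1, i.2⟩ (by simp))
    (fun i j hij => by
      apply AlgEquiv.ext
      intro x
      refine DFunLike.congr_fun (crossHom_comm ?_ ?_ ?_ ?_ ?_ ?_) x <;>
        simp [Fin.ext_iff] <;> omega)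
    (fun i j hij => by
      obtain ⟨j, hj⟩ := j
      simp only at hij
      subst hij
      apply AlgEquiv.ext
      intro x
      refine DFunLike.congr_fun (crossHom_braid ?_ ?_ ?_) x <;>
        (simp [Fin.ext_iff]; try omega))

/-- The inclusion `𝒜_n → 𝒜_{n+1}`, `a_{ij} ↦ a_{ij}`. -/
def cordIncl (n : ℕ) : CordAlg (Fin n) →ₐ[ℤ] CordAlg (Fin (n + 1)) :=
  FreeAlgebra.lift ℤ fun x => cord x.1.1.castSucc x.1.2.castSucc

/-- `φ*_β`: the automorphism of `𝒜_{n+1}` given by `β` included in `B_{n+1}`. -/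
def phiStar {n : ℕ} (β : BraidGroup n) : CordAlg (Fin (n + 1)) ≃ₐ[ℤ] CordAlg (Fin (n + 1)) :=
  phi (n + 1) (braidIncl n.le_succ β)

/-! ### The matrices `Φ^L` and `Φ^R` -/

section Phi

variable {n : ℕ}

theorem cordIncl_cord (i j : Fin n) :
    cordIncl n (cord i j) = cord i.castSucc j.castSucc := by
  by_cases h : i = j
  · subst h; simp [cord]
  · simp [cordIncl, cord, h]

/-- `x` lies in the left `𝒜_n`-span of the `a_{j,n+1}`. -/
def InLeft (x : CordAlg (Fin (n + 1))) : Prop :=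
  ∃ r : Fin n → CordAlg (Fin n),
    x = ∑ j, cordIncl n (r j) * cord j.castSucc (Fin.last n)

/-- `x` lies in the right `𝒜_n`-span of the `a_{n+1,j}`. -/
def InRight (x : CordAlg (Fin (n + 1))) : Prop :=
  ∃ r : Fin n → CordAlg (Fin n),
    x = ∑ j, cord (Fin.last n) j.castSucc * cordIncl n (r j)

theorem InLeft.cord (j : Fin n) : InLeft (cord j.castSucc (Fin.last n)) :=
  ⟨Pi.single j 1, by simp [Pi.single_apply, apply_ite (cordIncl n)]⟩

theorem InRight.cord (j : Fin n) : InRight (cord (Fin.last n) j.castSucc) :=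
  ⟨Pi.single j 1, by simp [Pi.single_apply, apply_ite (cordIncl n)]⟩

theorem InLeft.sub {x y : CordAlg (Fin (n + 1))} (hx : InLeft x) (hy : InLeft y) :
    InLeft (x - y) := by
  obtain ⟨r, rfl⟩ := hx
  obtain ⟨q, rfl⟩ := hy
  exact ⟨r - q, by simp [sub_mul, Finset.sum_sub_distrib]⟩

theorem InRight.sub {x y : CordAlg (Fin (n + 1))} (hx : InRight x) (hy : InRight y) :
    InRight (x - y) := by
  obtain ⟨r, rfl⟩ := hx
  obtain ⟨q, rfl⟩ := hy
  exact ⟨r - q, by simp [mul_sub, Finset.sum_sub_distrib]⟩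

theorem InLeft.mul (y : CordAlg (Fin n)) {x : CordAlg (Fin (n + 1))} (hx : InLeft x) :
    InLeft (cordIncl n y * x) := by
  obtain ⟨r, rfl⟩ := hx
  exact ⟨fun j => y * r j, by simp [Finset.mul_sum, mul_assoc]⟩

theorem InRight.mul (y : CordAlg (Fin n)) {x : CordAlg (Fin (n + 1))} (hx : InRight x) :
    InRight (x * cordIncl n y) := by
  obtain ⟨r, rfl⟩ := hx
  exact ⟨fun j => r j * y, by simp [Finset.sum_mul, mul_assoc]⟩

theorem InLeft.sum {ι : Type} (t : Finset ι) (f : ι → CordAlg (Fin (n + 1)))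
    (h : ∀ i ∈ t, InLeft (f i)) : InLeft (∑ i ∈ t, f i) := by
  classical
  induction t using Finset.induction_on with
  | empty => exact ⟨0, by simp⟩
  | insert a t ha ih =>
    rw [Finset.sum_insert ha, ← sub_neg_eq_add, ← zero_sub]
    exact (h a (by simp)).sub (InLeft.sub ⟨0, by simp⟩ (ih fun i hi => h i (by simp [hi])))

theorem InRight.sum {ι : Type} (t : Finset ι) (f : ι → CordAlg (Fin (n + 1)))
    (h : ∀ i ∈ t, InRight (f i)) : InRight (∑ i ∈ t, f i) := by
  classical
  induction t using Finset.induction_on with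
  | empty => exact ⟨0, by simp⟩
  | insert a t ha ih =>
    rw [Finset.sum_insert ha, ← sub_neg_eq_add, ← zero_sub]
    exact (h a (by simp)).sub (InRight.sub ⟨0, by simp⟩ (ih fun i hi => h i (by simp [hi])))

/-- `F` extends `f`, and preserves the two spans above. -/
structure Compat (f : CordAlg (Fin n) →ₐ[ℤ] CordAlg (Fin n))
    (F : CordAlg (Fin (n + 1)) →ₐ[ℤ] CordAlg (Fin (n + 1))) : Prop where
  incl : ∀ y, F (cordIncl n y) = cordIncl n (f y)
  left : ∀ j : Fin n, InLeft (F (cord j.castSucc (Fin.last n)))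
  right : ∀ j : Fin n, InRight (F (cord (Fin.last n) j.castSucc))

theorem Compat.comp {f g : CordAlg (Fin n) →ₐ[ℤ] CordAlg (Fin n)}
    {F G : CordAlg (Fin (n + 1)) →ₐ[ℤ] CordAlg (Fin (n + 1))} (hf : Compat f F)
    (hg : Compat g G) : Compat (f.comp g) (F.comp G) where
  incl y := by simp [hf.incl, hg.incl]
  left j := by
    obtain ⟨r, hr⟩ := hg.left j
    rw [AlgHom.comp_apply, hr, map_sum]
    refine InLeft.sum _ _ fun i _ => ?_
    rw [map_mul, hf.incl]
    exact (hf.left i).mul _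
  right j := by
    obtain ⟨r, hr⟩ := hg.right j
    rw [AlgHom.comp_apply, hr, map_sum]
    refine InRight.sum _ _ fun i _ => ?_
    rw [map_mul, hf.incl]
    exact (hf.right i).mul _

theorem compat_crossHom (s t : Fin n) :
    Compat (crossHom s t) (crossHom s.castSucc t.castSucc) where
  incl y := by
    refine DFunLike.congr_fun (f := (crossHom s.castSucc t.castSucc).comp (cordIncl n))
      (g := (cordIncl n).comp (crossHom s t)) (cordHom_ext fun i j hij => ?_) y
    rw [AlgHom.comp_apply, AlgHom.comp_apply, cordIncl_cord, crossHom_cord _ _ hij,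
      crossHom_cord _ _ (by simpa using hij)]
    simp only [crossFun, (Fin.castSucc_injective n).eq_iff]
    split_ifs <;> simp [cordIncl_cord]
  left j := by
    rw [crossHom_cord _ _ (Fin.castSucc_lt_last j).ne]
    have hs : Fin.last n ≠ s.castSucc := (Fin.castSucc_lt_last s).ne'
    have ht : Fin.last n ≠ t.castSucc := (Fin.castSucc_lt_last t).ne'
    simp only [crossFun, (Fin.castSucc_injective n).eq_iff, hs, ht, if_false]
    split_ifs
    · rw [← cordIncl_cord]
      exact (InLeft.cord t).sub ((InLeft.cord s).mul _)
    · exact InLeft.cord s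
    · exact InLeft.cord j
  right j := by
    rw [crossHom_cord _ _ (Fin.castSucc_lt_last j).ne']
    have hs : Fin.last n ≠ s.castSucc := (Fin.castSucc_lt_last s).ne'
    have ht : Fin.last n ≠ t.castSucc := (Fin.castSucc_lt_last t).ne'
    simp only [crossFun, (Fin.castSucc_injective n).eq_iff, hs, ht, if_false]
    split_ifs
    · rw [← cordIncl_cord]
      exact (InRight.cord t).sub ((InRight.cord s).mul _)
    · exact InRight.cord s
    · exact InRight.cord j

theorem compat_phi (β : BraidGroup n) :
    Compat (phi n β : CordAlg (Fin n) →ₐ[ℤ] CordAlg (Fin n))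
      (phiStar β : CordAlg (Fin (n + 1)) →ₐ[ℤ] CordAlg (Fin (n + 1))) := by
  have key : ∀ i : BraidGen n,
      phi n (PresentedGroup.of i) =
        crossEquiv ⟨i, Nat.lt_of_succ_lt i.2⟩ ⟨i + 1, i.2⟩ (by simp) ∧
      phiStar (PresentedGroup.of i : BraidGroup n) =
        crossEquiv (Fin.castSucc ⟨i, Nat.lt_of_succ_lt i.2⟩) (Fin.castSucc ⟨i + 1, i.2⟩)
          (by simp) := by
    intro i
    refine ⟨braidLift_of _ _ _ _, ?_⟩
    rw [phiStar, braidIncl, braidLift_of, sigma, dif_pos (Nat.lt_succ_of_lt i.2), phi,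
      braidLift_of]
    rfl
  obtain ⟨w, rfl⟩ := PresentedGroup.mk_surjective (braidRels n) β
  induction w using FreeGroup.induction_on with
  | C1 =>
    rw [map_one, map_one, phiStar, map_one, map_one]
    exact ⟨fun y => rfl, InLeft.cord, InRight.cord⟩
  | of i =>
    have h := key i
    simp only [PresentedGroup.of] at h
    rw [h.1, h.2]
    exact compat_crossHom _ _
  | inv_of i _ =>
    have h := key i
    simp only [PresentedGroup.of, phiStar] at h
    rw [phiStar, map_inv, map_inv, map_inv, map_inv, h.1, h.2]
    exact compat_crossHom _ _
  | mul x y hx hy =>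
    rw [phiStar] at *
    rw [map_mul, map_mul, map_mul, map_mul]
    exact hx.comp hy

/-- A representation of `𝒜_{n+1}` that detects coefficients with respect to the `a_{j,n+1}` and
the `a_{n+1,j}`. -/
def detect (k : Fin n) :
    CordAlg (Fin (n + 1)) →ₐ[ℤ] Matrix (Fin 2) (Fin 2) (CordAlg (Fin n)) :=
  FreeAlgebra.lift ℤ fun x =>
    Fin.lastCases (motive := fun _ => Matrix (Fin 2) (Fin 2) (CordAlg (Fin n)))
      (Fin.lastCases (motive := fun _ => Matrix (Fin 2) (Fin 2) (CordAlg (Fin n))) 0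
        (fun j => if j = k then !![0, 0; 1, 0] else 0) x.1.2)
      (fun i =>
        Fin.lastCases (motive := fun _ => Matrix (Fin 2) (Fin 2) (CordAlg (Fin n)))
          (if i = k then !![0, 1; 0, 0] else 0) (fun j => !![cord i j, 0; 0, 0]) x.1.2) x.1.1

theorem detect_left (k j : Fin n) :
    detect k (cord j.castSucc (Fin.last n)) = if j = k then !![0, 1; 0, 0] else 0 := by
  simp [detect, cord, (Fin.castSucc_lt_last j).ne]

theorem detect_right (k j : Fin n) :
    detect k (cord (Fin.last n) j.castSucc) = if j = k then !![0, 0; 1, 0] else 0 := by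
  simp [detect, cord, (Fin.castSucc_lt_last j).ne']

theorem detect_incl (k : Fin n) (y : CordAlg (Fin n)) :
    detect k (cordIncl n y) 0 0 = y ∧ detect k (cordIncl n y) 0 1 = 0 ∧
      detect k (cordIncl n y) 1 0 = 0 := by
  induction y using FreeAlgebra.induction with
  | grade0 r => 
    rw [AlgHom.commutes, AlgHom.commutes]
    simp [Matrix.algebraMap_matrix_apply]
  | grade1 x =>
    obtain ⟨⟨i, j⟩, h⟩ := x
    have h' : i ≠ j := h
    simp [cordIncl, detect, cord, h']
  | mul a b ha hb => simp [Matrix.mul_apply, Fin.sum_univ_two, ha, hb]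
  | add a b ha hb => simp [ha, hb]

theorem detect_left_sum (k : Fin n) (r : Fin n → CordAlg (Fin n)) :
    detect k (∑ j, cordIncl n (r j) * cord j.castSucc (Fin.last n)) 0 1 = r k := by
  rw [map_sum, Matrix.sum_apply, Finset.sum_eq_single k]
  · rw [map_mul, detect_left, if_pos rfl, Matrix.mul_apply, Fin.sum_univ_two,
      (detect_incl k (r k)).1]
    simp
  · intro j _ hj
    rw [map_mul, detect_left, if_neg hj, mul_zero, Matrix.zero_apply]
  · simp

theorem detect_right_sum (k : Fin n) (r : Fin n → CordAlg (Fin n)) :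
    detect k (∑ j, cord (Fin.last n) j.castSucc * cordIncl n (r j)) 1 0 = r k := by
  rw [map_sum, Matrix.sum_apply, Finset.sum_eq_single k]
  · rw [map_mul, detect_right, if_pos rfl, Matrix.mul_apply, Fin.sum_univ_two,
      (detect_incl k (r k)).1]
    simp
  · intro j _ hj
    rw [map_mul, detect_right, if_neg hj, zero_mul, Matrix.zero_apply]
  · simp

theorem existsUnique_PhiL (β : BraidGroup n) :
    ∃! M : Matrix (Fin n) (Fin n) (CordAlg (Fin n)), ∀ i,
      phiStar β (cord i.castSucc (Fin.last n)) =
        ∑ j, cordIncl n (M i j) * cord j.castSucc (Fin.last n) := by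
  choose r hr using (compat_phi β).left
  refine ⟨Matrix.of r, hr, fun M hM => ?_⟩
  ext1 i j
  rw [← detect_left_sum j (M i), ← hM i, ← detect_left_sum j (Matrix.of r i)]
  exact congrArg (fun x => detect j x 0 1) (hr i)

theorem existsUnique_PhiR (β : BraidGroup n) :
    ∃! M : Matrix (Fin n) (Fin n) (CordAlg (Fin n)), ∀ i,
      phiStar β (cord (Fin.last n) i.castSucc) =
        ∑ j, cord (Fin.last n) j.castSucc * cordIncl n (M j i) := by
  choose r hr using (compat_phi β).right
  refine ⟨Matrix.of fun j i => r i j, hr, fun M hM => ?_⟩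
  ext1 j i
  have h := hM i
  calc M j i = detect j (phiStar β (cord (Fin.last n) i.castSucc)) 1 0 := by
        rw [h, detect_right_sum j (fun j => M j i)]
    _ = r i j := by
        rw [← detect_right_sum j (r i)]
        exact congrArg (fun x => detect j x 1 0) (hr i)

end Phi

/-- The matrix `Φ^L_β`, determined by `φ*_β(a_{i,n+1}) = ∑ j, (Φ^L_β)_{ij} a_{j,n+1}`. -/
noncomputable def PhiL {n : ℕ} (β : BraidGroup n) : Matrix (Fin n) (Fin n) (CordAlg (Fin n)) :=
  (existsUnique_PhiL β).choose

/-- The matrix `Φ^R_β`, determined by `φ*_β(a_{n+1,i}) = ∑ j, a_{n+1,j} (Φ^R_β)_{ji}`. -/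
noncomputable def PhiR {n : ℕ} (β : BraidGroup n) : Matrix (Fin n) (Fin n) (CordAlg (Fin n)) :=
  (existsUnique_PhiR β).choose

theorem PhiL_spec {n : ℕ} (β : BraidGroup n) (i : Fin n) :
    phiStar β (cord i.castSucc (Fin.last n)) =
      ∑ j, cordIncl n (PhiL β i j) * cord j.castSucc (Fin.last n) :=
  (existsUnique_PhiL β).choose_spec.1 i

theorem PhiR_spec {n : ℕ} (β : BraidGroup n) (i : Fin n) :
    phiStar β (cord (Fin.last n) i.castSucc) =
      ∑ j, cord (Fin.last n) j.castSucc * cordIncl n (PhiR β j i) :=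
  (existsUnique_PhiR β).choose_spec.1 i

/-! ### Augmentations and augmentation rank -/

/-- `R₀ = ℤ[λ^{±1}, μ^{±1}]`, as the group ring of `ℤ × ℤ`; the exponent `(a, b)` stands for
`λ^a μ^b`. -/
abbrev R₀ : Type := AddMonoidAlgebra ℤ (ℤ × ℤ)

/-- The Laurent monomial `λ^a μ^b`. -/
noncomputable def laurent (a b : ℤ) : R₀ := AddMonoidAlgebra.single (a, b) 1

/-- The variable `μ`. -/
noncomputable def mu : R₀ := laurent 0 1

/-- The ring `𝒜_n ⊗ R₀` (tensor product over `ℤ`). -/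
abbrev CordAlgR (n : ℕ) : Type := CordAlg (Fin n) ⊗[ℤ] R₀

/-- The matrix `𝐀`. -/
noncomputable def matA (n : ℕ) : Matrix (Fin n) (Fin n) (CordAlgR n) :=
  Matrix.of fun i j =>
    if i < j then cord i j ⊗ₜ[ℤ] 1
    else if j < i then cord i j ⊗ₜ[ℤ] (-mu)
    else 1 ⊗ₜ[ℤ] (1 - mu)

/-- The matrix `𝚲 = diag[λ μ^{ω(β)}, 1, …, 1]`. -/
noncomputable def matLambda {n : ℕ} (β : BraidGroup n) : Matrix (Fin n) (Fin n) (CordAlgR n) :=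
  Matrix.diagonal fun i => 1 ⊗ₜ[ℤ] (if (i : ℕ) = 0 then laurent 1 (writhe β) else 1)

/-- The matrix `𝚲⁻¹ = diag[λ⁻¹ μ^{-ω(β)}, 1, …, 1]`. -/
noncomputable def matLambdaInv {n : ℕ} (β : BraidGroup n) :
    Matrix (Fin n) (Fin n) (CordAlgR n) :=
  Matrix.diagonal fun i => 1 ⊗ₜ[ℤ] (if (i : ℕ) = 0 then laurent (-1) (-writhe β) else 1)

theorem matLambda_mul_inv {n : ℕ} (β : BraidGroup n) :
    matLambda β * matLambdaInv β = 1 ∧ matLambdaInv β * matLambda β = 1 := by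
  simp only [matLambda, matLambdaInv, Matrix.diagonal_mul_diagonal,
    Algebra.TensorProduct.tmul_mul_tmul, one_mul]
  constructor
  all_goals
    rw [← Matrix.diagonal_one]
    congr 1
    funext i
    split_ifs <;> simp [laurent, AddMonoidAlgebra.single_mul_single,
      AddMonoidAlgebra.one_def, Algebra.TensorProduct.one_def, ← Prod.zero_eq_mk]

/-- The entries of a matrix over `𝒜_n`, regarded in `𝒜_n ⊗ R₀`. -/
noncomputable def extend {n : ℕ} (M : Matrix (Fin n) (Fin n) (CordAlg (Fin n))) :
    Matrix (Fin n) (Fin n) (CordAlgR n) :=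
  M.map fun x => x ⊗ₜ[ℤ] 1

/-- The two-sided ideal `ℐ` generated by the entries of `𝐀 - 𝚲 Φ^L_β 𝐀` and
`𝐀 - 𝐀 Φ^R_β 𝚲⁻¹`; the quotient of `𝒜_n ⊗ R₀` by it is `HC_0` of the closure of `β`. -/
noncomputable def augIdeal {n : ℕ} (β : BraidGroup n) : TwoSidedIdeal (CordAlgR n) :=
  TwoSidedIdeal.span
    ({x | ∃ i j, x = (matA n - matLambda β * extend (PhiL β) * matA n) i j} ∪
     {x | ∃ i j, x = (matA n - matA n * extend (PhiR β) * matLambdaInv β) i j})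

/-- An augmentation of the closure of `β`: a unital ring homomorphism `𝒜_n ⊗ R₀ → ℂ` that
vanishes on `ℐ`. -/
def IsAugmentation {n : ℕ} (β : BraidGroup n) (ε : CordAlgR n →+* ℂ) : Prop :=
  ∀ x ∈ augIdeal β, ε x = 0

/-- The rank of an augmentation `ε` (with `ε(μ) ≠ 1`): the rank of the complex matrix `ε(𝐀)`. -/
noncomputable def augRank {n : ℕ} (ε : CordAlgR n →+* ℂ) : ℕ := ((matA n).map ε).rank

/-- The ranks of the augmentations `ε` with `ε(μ) ≠ 1` of the closure of `β`. -/
def augRanks {n : ℕ} (β : BraidGroup n) : Set ℕ :=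
  {r | ∃ ε : CordAlgR n →+* ℂ, IsAugmentation β ε ∧ ε (1 ⊗ₜ[ℤ] mu) ≠ 1 ∧ augRank ε = r}

theorem bddAbove_augRanks {n : ℕ} (β : BraidGroup n) : BddAbove (augRanks β) := by
  refine ⟨n, ?_⟩
  rintro r ⟨ε, -, -, rfl⟩
  simpa [augRank] using ((matA n).map ε).rank_le_width

/-- The augmentation rank `ar` of the closure of the braid `β`: the maximal rank of an
augmentation. -/
noncomputable def ar {n : ℕ} (β : BraidGroup n) : ℕ := sSup (augRanks β)

end BraidSatellite

namespace BraidSatellite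

/-! ### Inductions over the braid group -/

/-! An augmentation of full rank n sends 𝐀 to an invertible matrix, which can be cancelled from both
families of relations. What is left is a condition on a homomorphism ε : 𝒜_n → ℂ alone: Φ^L_β goes
to diag(c, 1, …, 1) and Φ^R_β to its inverse (`exists_isDiagonal_of_ar_eq`). Conversely, any such ε
gives an augmentation of rank n (`ar_eq_of_isDiagonal`): write ε(𝐀) = U - μL with U and L
unitriangular, take μ generic so that this is invertible, and choose λ so that λμ^ω = c⁻¹. The
theorem is thus about building one homomorphism out of 𝒜_{kp} from homomorphisms c for α and g for
γ.

Take the homomorphism whose triangular matrices are the Kronecker products U_c ⊗ U_g and L_c ⊗ L_g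
(`satelliteHom`). The main point is that Φ^L of the p-parallel of a braid β then evaluates to Φ^L_β
⊗ 1. For a single block crossing, Φ^L is a permutation matrix except in one unknown p × p block
(`isBlockCrossing_blockCross`). The identity L_{ε·β} = Φ^L L_ε Φ^R (`lowerMat_act`) forces that
block, because L has zeros above its diagonal (`evalL_parallel_of`). The cocycle rule for Φ^L
carries the result from generators to all braids (`evalL_parallel`).

The braid γ acts on the first block only, where the Kronecker homomorphism restricts to g. Hence Φ^L
of the satellite evaluates to (Φ^L_γ(g) ⊕ 1)(Φ^L_α(c) ⊗ 1), whose second factor is u on the first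
block and 1 elsewhere. To obtain diag(t, 1, …, 1), Φ^L_γ(g) has to be u⁻¹ diag(t, 1, …, 1).
Replacing a_{ij} by s_i s_j⁻¹ a_{ij} multiplies the diagonal entry d_i by s_{π(i)} s_i⁻¹. As γ
closes up to a knot, π is a p-cycle, so every diagonal with the same product is reachable
(`IsDiagonal.exists_rescale`), and this fixes t = u^p v, where g starts with diag(v, 1, …, 1). -/

theorem braid_induction {n : ℕ} {P : BraidGroup n → Prop} (one : P 1)
    (of : ∀ i : BraidGen n, P (PresentedGroup.of i)) (mul : ∀ a b, P a → P b → P (a * b))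
    (inv : ∀ a, P a → P a⁻¹) (β : BraidGroup n) : P β := by
  obtain ⟨w, rfl⟩ := PresentedGroup.mk_surjective (braidRels n) β
  induction w using FreeGroup.induction_on with
  | C1 => simpa using one
  | of i => exact of i
  | inv_of i h => simpa using inv _ h
  | mul x y hx hy => simpa using mul _ _ hx hy

/-- A right action of a group, as a function. -/
structure IsRightAction {G X : Type*} [Group G] (act : X → G → X) : Prop where
  one : ∀ x, act x 1 = x
  mul : ∀ x a b, act x (a * b) = act (act x a) b

/-- A cocycle over a right action, with values in a monoid. -/
structure IsCocycle {G X M : Type*} [Group G] [Monoid M] (act : X → G → X) (v : X → G → M) :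
    Prop where
  one : ∀ x, v x 1 = 1
  mul : ∀ x a b, v x (a * b) = v (act x a) b * v x a

section ext

variable {n : ℕ} {X Y M : Type*} [Monoid M]

theorem IsRightAction.equivariant {act : X → BraidGroup n → X} {act' : Y → BraidGroup n → Y}
    (h : IsRightAction act) (h' : IsRightAction act') (F : X → Y)
    (of : ∀ x (i : BraidGen n),
      F (act x (PresentedGroup.of i)) = act' (F x) (PresentedGroup.of i))
    (β : BraidGroup n) (x : X) : F (act x β) = act' (F x) β := by
  induction β using braid_induction generalizing x with
  | one => rw [h.one, h'.one]
  | of i => exact of x i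
  | mul a b ha hb => rw [h.mul, h'.mul, hb, ha]
  | inv a ha =>
    have := ha (act x a⁻¹)
    rw [← h.mul, inv_mul_cancel, h.one] at this
    rw [this, ← h'.mul, mul_inv_cancel, h'.one]

/-- The cocycle rule determines the value on a product from those on its factors. For inverses no
cancellation in `M` is needed: the values on `a` and `a⁻¹` at matching points are two-sided inverses
of each other, and inverses in a monoid are unique. -/
theorem IsCocycle.ext {act : X → BraidGroup n → X} (h : IsRightAction act)
    {v w : X → BraidGroup n → M} (hv : IsCocycle act v) (hw : IsCocycle act w)
    (of : ∀ x (i : BraidGen n), v x (PresentedGroup.of i) = w x (PresentedGroup.of i))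
    (β : BraidGroup n) (x : X) : v x β = w x β := by
  induction β using braid_induction generalizing x with
  | one => rw [hv.one, hw.one]
  | of i => exact of x i
  | mul a b ha hb => rw [hv.mul, hw.mul, hb, ha]
  | inv a ha =>
    have h1 : v (act x a⁻¹) a * v x a⁻¹ = 1 := by rw [← hv.mul, inv_mul_cancel, hv.one]
    have h2 : w x a⁻¹ * w (act x a⁻¹) a = 1 := by
      have := hw.mul (act x a⁻¹) a a⁻¹
      rwa [mul_inv_cancel, hw.one, ← h.mul, inv_mul_cancel, h.one, eq_comm] at this
    rw [← ha] at h2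
    exact (left_inv_eq_right_inv h2 h1).symm

end ext

/-! ### The matrices `Φ^L` and `Φ^R` of products and of generators -/

section cocycle

variable {n : ℕ}

/-- Since φ* of `a * b` is φ*_a ∘ φ*_b, the coefficients coming from `b` are transformed by φ_a
before those of `a` enter. Uniqueness of the coefficients then identifies the matrix. -/
theorem PhiL_mul (a b : BraidGroup n) : PhiL (a * b) = (PhiL b).map (phi n a) * PhiL a := by
  refine (existsUnique_PhiL (a * b)).unique (PhiL_spec _) fun i => ?_
  have h : phiStar (a * b) (cord i.castSucc (Fin.last n)) =
      phiStar a (phiStar b (cord i.castSucc (Fin.last n))) := by simp [phiStar]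
  have hi : ∀ y, phiStar a (cordIncl n y) = cordIncl n (phi n a y) := (compat_phi a).incl
  rw [h, PhiL_spec b, map_sum]
  simp only [map_mul, hi, PhiL_spec a, Matrix.mul_apply, Matrix.map_apply, map_sum,
    Finset.sum_mul, Finset.mul_sum, mul_assoc]
  exact Finset.sum_comm

theorem PhiR_mul (a b : BraidGroup n) : PhiR (a * b) = PhiR a * (PhiR b).map (phi n a) := by
  refine (existsUnique_PhiR (a * b)).unique (PhiR_spec _) fun i => ?_
  have h : phiStar (a * b) (cord (Fin.last n) i.castSucc) =
      phiStar a (phiStar b (cord (Fin.last n) i.castSucc)) := by simp [phiStar]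
  have hi : ∀ y, phiStar a (cordIncl n y) = cordIncl n (phi n a y) := (compat_phi a).incl
  rw [h, PhiR_spec b, map_sum]
  simp only [map_mul, hi, PhiR_spec a, Matrix.mul_apply, Matrix.map_apply, map_sum,
    Finset.sum_mul, Finset.mul_sum, mul_assoc]
  exact Finset.sum_comm

theorem PhiL_one : PhiL (1 : BraidGroup n) = 1 := by
  refine (existsUnique_PhiL 1).unique (PhiL_spec _) fun i => ?_
  simp [phiStar, Matrix.one_apply, apply_ite (cordIncl n)]

theorem PhiR_one : PhiR (1 : BraidGroup n) = 1 := by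
  refine (existsUnique_PhiR 1).unique (PhiR_spec _) fun i => ?_
  simp [phiStar, Matrix.one_apply, apply_ite (cordIncl n)]

/-- The first of the two strands that cross in an Artin generator. -/
abbrev BraidGen.fst (i : BraidGen n) : Fin n := ⟨i, Nat.lt_of_succ_lt i.2⟩

/-- The second of the two strands that cross in an Artin generator. -/
abbrev BraidGen.snd (i : BraidGen n) : Fin n := ⟨i + 1, i.2⟩

theorem phi_of_cord (g : BraidGen n) {i j : Fin n} (h : i ≠ j) :
    phi n (PresentedGroup.of g) (cord i j) = crossFun g.fst g.snd i j := by
  rw [phi, braidLift_of]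
  exact crossHom_cord _ _ h

theorem phiStar_of_cord (g : BraidGen n) {i j : Fin (n + 1)} (h : i ≠ j) :
    phiStar (PresentedGroup.of g : BraidGroup n) (cord i j) =
      crossFun g.fst.castSucc g.snd.castSucc i j := by
  rw [phiStar, braidIncl, braidLift_of, sigma, dif_pos (Nat.lt_succ_of_lt g.2)]
  exact phi_of_cord ⟨g, Nat.lt_succ_of_lt g.2⟩ h

theorem PhiL_of (g : BraidGen n) (i : Fin n) :
    PhiL (PresentedGroup.of g) i =
      if i = g.fst then Pi.single g.snd 1 - Pi.single g.fst (cord g.snd g.fst)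
      else if i = g.snd then Pi.single g.fst 1 else Pi.single i 1 := by
  refine congrFun ((existsUnique_PhiL (PresentedGroup.of g)).unique (PhiL_spec _)
    (y₂ := fun i => if i = g.fst then Pi.single g.snd 1 - Pi.single g.fst (cord g.snd g.fst)
      else if i = g.snd then Pi.single g.fst 1 else Pi.single i 1) fun i => ?_) i
  rw [phiStar_of_cord _ (Fin.castSucc_lt_last i).ne]
  have h1 := (Fin.castSucc_lt_last g.fst).ne'
  have h2 := (Fin.castSucc_lt_last g.snd).ne'
  simp only [crossFun, (Fin.castSucc_injective n).eq_iff, h1, h2, if_false, ← cordIncl_cord]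
  split_ifs <;> simp [Pi.single_apply, sub_mul, apply_ite (cordIncl n), Finset.sum_sub_distrib]

theorem PhiR_of (g : BraidGen n) (i : Fin n) :
    (PhiR (PresentedGroup.of g)).transpose i =
      if i = g.fst then Pi.single g.snd 1 - Pi.single g.fst (cord g.fst g.snd)
      else if i = g.snd then Pi.single g.fst 1 else Pi.single i 1 := by
  refine congrFun (congrArg Matrix.transpose
    ((existsUnique_PhiR (PresentedGroup.of g)).unique (PhiR_spec _)
    (y₂ := Matrix.of fun j i =>
      (if i = g.fst then Pi.single g.snd 1 - Pi.single g.fst (cord g.fst g.snd)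
      else if i = g.snd then Pi.single g.fst 1 else Pi.single i 1 : Fin n → _) j) fun i => ?_)) i
  rw [phiStar_of_cord _ (Fin.castSucc_lt_last i).ne']
  have h1 := (Fin.castSucc_lt_last g.fst).ne'
  have h2 := (Fin.castSucc_lt_last g.snd).ne'
  simp only [crossFun, (Fin.castSucc_injective n).eq_iff, h1, h2, if_false, ← cordIncl_cord,
    Matrix.of_apply]
  split_ifs <;> simp [Pi.single_apply, mul_sub, apply_ite (cordIncl n), Finset.sum_sub_distrib]

end cocycle

/-! ### The action on homomorphisms to a commutative ring -/

section states

variable {n : ℕ} {K : Type*} [CommRing K]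

/-- The braid group acts from the right on the homomorphisms out of `𝒜_n`. -/
noncomputable def act (ε : CordAlg (Fin n) →ₐ[ℤ] K) (β : BraidGroup n) :
    CordAlg (Fin n) →ₐ[ℤ] K :=
  ε.comp (phi n β : CordAlg (Fin n) →ₐ[ℤ] CordAlg (Fin n))

theorem isRightAction_act : IsRightAction (act (n := n) (K := K)) where
  one ε := by ext; simp [act]
  mul ε a b := by ext; simp [act]

/-- The image of `Φ^L` under a homomorphism. -/
noncomputable def evalL (ε : CordAlg (Fin n) →ₐ[ℤ] K) (β : BraidGroup n) :
    Matrix (Fin n) (Fin n) K :=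
  (PhiL β).map ε

/-- The image of `Φ^R` under a homomorphism. -/
noncomputable def evalR (ε : CordAlg (Fin n) →ₐ[ℤ] K) (β : BraidGroup n) :
    Matrix (Fin n) (Fin n) K :=
  (PhiR β).map ε

theorem isCocycle_evalL : IsCocycle (act (n := n) (K := K)) evalL where
  one ε := by rw [evalL, PhiL_one]; exact Matrix.map_one _ (map_zero ε) (map_one ε)
  mul ε a b := by
    rw [evalL, PhiL_mul, Matrix.map_mul, Matrix.map_map]
    rfl

theorem isCocycle_evalR_transpose :
    IsCocycle (act (n := n) (K := K)) fun ε β => (evalR ε β).transpose where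
  one ε := by
    rw [evalR, PhiR_one, Matrix.map_one _ (map_zero ε) (map_one ε), Matrix.transpose_one]
  mul ε a b := by
    rw [evalR, PhiR_mul, Matrix.map_mul, Matrix.map_map, Matrix.transpose_mul]
    rfl

/-- The homomorphism with prescribed values on the generators `a_{ij}`. -/
noncomputable def ofValues (f : Fin n → Fin n → K) : CordAlg (Fin n) →ₐ[ℤ] K :=
  FreeAlgebra.lift ℤ fun x => f x.1.1 x.1.2

theorem ofValues_cord (f : Fin n → Fin n → K) {i j : Fin n} (h : i ≠ j) :
    ofValues f (cord i j) = f i j := by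
  simp [ofValues, cord, h]

theorem act_of_cord (ε : CordAlg (Fin n) →ₐ[ℤ] K) (g : BraidGen n) {i j : Fin n} (h : i ≠ j) :
    act ε (PresentedGroup.of g) (cord i j) = ε (crossFun g.fst g.snd i j) :=
  congrArg ε (phi_of_cord g h)

theorem evalL_of (ε : CordAlg (Fin n) →ₐ[ℤ] K) (g : BraidGen n) (i : Fin n) :
    evalL ε (PresentedGroup.of g) i =
      if i = g.fst then Pi.single g.snd 1 - Pi.single g.fst (ε (cord g.snd g.fst))
      else if i = g.snd then Pi.single g.fst 1 else Pi.single i 1 := by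
  ext j
  rw [evalL, Matrix.map_apply, PhiL_of]
  split_ifs <;> simp [Pi.single_apply, apply_ite ε]

theorem evalR_of (ε : CordAlg (Fin n) →ₐ[ℤ] K) (g : BraidGen n) (i : Fin n) :
    (evalR ε (PresentedGroup.of g)).transpose i =
      if i = g.fst then Pi.single g.snd 1 - Pi.single g.fst (ε (cord g.fst g.snd))
      else if i = g.snd then Pi.single g.fst 1 else Pi.single i 1 := by
  ext j
  have := congrFun (PhiR_of g i) j
  rw [Matrix.transpose_apply] at this
  rw [evalR, Matrix.transpose_apply, Matrix.map_apply, this]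
  split_ifs <;> simp [Pi.single_apply, apply_ite ε]

/-- The homomorphism that exchanges the values on `a_{ij}` and `a_{ji}`. -/
noncomputable def flip (ε : CordAlg (Fin n) →ₐ[ℤ] K) : CordAlg (Fin n) →ₐ[ℤ] K :=
  ofValues fun i j => ε (cord j i)

theorem flip_cord (ε : CordAlg (Fin n) →ₐ[ℤ] K) (i j : Fin n) :
    flip ε (cord i j) = ε (cord j i) := by
  by_cases h : i = j
  · simp [h, cord]
  · exact ofValues_cord _ h

theorem flip_flip (ε : CordAlg (Fin n) →ₐ[ℤ] K) : flip (flip ε) = ε :=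
  cordHom_ext fun i j _ => by rw [flip_cord, flip_cord]

/-- The formulas for the generators are symmetric under a_{ij} ↔ a_{ji} combined with reversing
products. Reversal is invisible because `K` is commutative. -/
theorem flip_act (β : BraidGroup n) (ε : CordAlg (Fin n) →ₐ[ℤ] K) :
    flip (act ε β) = act (flip ε) β := by
  refine isRightAction_act.equivariant isRightAction_act flip (fun ε g => ?_) β ε
  refine cordHom_ext fun i j h => ?_
  rw [flip_cord, act_of_cord _ _ h, act_of_cord _ _ h.symm]
  simp only [crossFun]
  split_ifs <;> simp_all [flip_cord, mul_comm]

/-- Both sides are cocycles that agree on generators. This reduces every statement about Φ^R to one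
about Φ^L. -/
theorem evalR_transpose (β : BraidGroup n) (ε : CordAlg (Fin n) →ₐ[ℤ] K) :
    (evalR ε β).transpose = evalL (flip ε) β := by
  refine isCocycle_evalR_transpose.ext (w := fun ε β => evalL (flip ε) β) isRightAction_act
    ⟨fun ε => isCocycle_evalL.one _, fun ε a b => ?_⟩ (fun ε g => ?_) β ε
  · rw [flip_act]
    exact isCocycle_evalL.mul _ _ _
  · ext i j
    refine congrFun ((evalR_of ε g i).trans ?_) j
    rw [evalL_of, flip_cord]

theorem evalR_eq (ε : CordAlg (Fin n) →ₐ[ℤ] K) (β : BraidGroup n) :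
    evalR ε β = (evalL (flip ε) β).transpose := by
  rw [← evalR_transpose, Matrix.transpose_transpose]

end states

/-! ### Triangular matrices -/

section triangular

variable {n : ℕ} {K : Type*} [CommRing K]

/-- The lower unitriangular matrix with entries `ε(a_{ij})`. -/
noncomputable def lowerMat (ε : CordAlg (Fin n) →ₐ[ℤ] K) : Matrix (Fin n) (Fin n) K :=
  Matrix.of fun i j => if j < i then ε (cord i j) else if i = j then 1 else 0

/-- The upper unitriangular matrix with entries `ε(a_{ij})`. -/
noncomputable def upperMat (ε : CordAlg (Fin n) →ₐ[ℤ] K) : Matrix (Fin n) (Fin n) K :=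
  Matrix.of fun i j => if i < j then ε (cord i j) else if i = j then 1 else 0

theorem upperMat_eq (ε : CordAlg (Fin n) →ₐ[ℤ] K) :
    upperMat ε = (lowerMat (flip ε)).transpose := by
  ext i j
  simp [upperMat, lowerMat, flip_cord, eq_comm]

theorem lowerMat_self (ε : CordAlg (Fin n) →ₐ[ℤ] K) (i : Fin n) : lowerMat ε i i = 1 := by
  simp [lowerMat]

theorem lowerMat_of_lt (ε : CordAlg (Fin n) →ₐ[ℤ] K) {i j : Fin n} (h : i < j) :
    lowerMat ε i j = 0 := by
  simp [lowerMat, h.not_gt, h.ne]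

theorem eq_of_lowerMat_eq_of_upperMat_eq {ε ε' : CordAlg (Fin n) →ₐ[ℤ] K}
    (hl : lowerMat ε = lowerMat ε') (hu : upperMat ε = upperMat ε') : ε = ε' := by
  refine cordHom_ext fun i j h => ?_
  rcases lt_or_gt_of_ne h with h | h
  · simpa [upperMat, h] using congrFun (congrFun hu i) j
  · simpa [lowerMat, h] using congrFun (congrFun hl i) j

theorem det_upperMat (ε : CordAlg (Fin n) →ₐ[ℤ] K) : (upperMat ε).det = 1 := by
  rw [Matrix.det_of_isUpperTriangular]
  · simp [upperMat]
  · intro i j h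
    have h' : j < i := h
    simp [upperMat, h'.not_gt, h'.ne']

theorem det_lowerMat (ε : CordAlg (Fin n) →ₐ[ℤ] K) : (lowerMat ε).det = 1 := by
  have := det_upperMat (flip ε)
  rwa [upperMat_eq, Matrix.det_transpose, flip_flip] at this

theorem mul_mul_apply_eq {l m n o : Type*} [Fintype m] [Fintype n] (A : Matrix l m K)
    (B : Matrix m n K) (C : Matrix n o K) (i : l) (j : o) :
    (A * B * C) i j = A i ⬝ᵥ B.mulVec (C.transpose j) := by
  rw [Matrix.dotProduct_mulVec, Matrix.mul_apply]
  rfl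

/-- A check entry by entry. Row and column operations by Φ^L and Φ^R keep the matrix lower
unitriangular only because the two crossing strands are neighbours. -/
theorem lowerMat_act_of (ε : CordAlg (Fin n) →ₐ[ℤ] K) (g : BraidGen n) :
    lowerMat (act ε (PresentedGroup.of g)) =
      evalL ε (PresentedGroup.of g) * lowerMat ε * evalR ε (PresentedGroup.of g) := by
  have hlt : g.fst < g.snd := by simp [Fin.lt_def]
  -- Adjacency of the crossing strands: every other index lies below both or above both, which
  -- leaves finitely many order types for (i, j).
  have hx : ∀ x : Fin n, x ≠ g.fst → x ≠ g.snd →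
      (x < g.fst ∧ x < g.snd ∧ ¬ g.fst < x ∧ ¬ g.snd < x) ∨
      (¬ x < g.fst ∧ ¬ x < g.snd ∧ g.fst < x ∧ g.snd < x) := by
    intro x h1 h2
    simp only [ne_eq, Fin.ext_iff, Fin.lt_def] at h1 h2 ⊢
    omega
  ext i j
  rw [mul_mul_apply_eq, evalL_of, evalR_of]
  have hl : lowerMat (act ε (PresentedGroup.of g)) i j = if j < i then
      ε (crossFun g.fst g.snd i j) else if i = j then 1 else 0 := by
    by_cases h : j < i
    · simp [lowerMat, h, act_of_cord ε g h.ne']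
    · simp [lowerMat, h]
  rw [hl]
  generalize g.fst = s at *
  generalize g.snd = t at *
  have h1 := hlt.ne
  have h2 := hlt.ne'
  have h3 := hlt.not_gt
  by_cases his : i = s <;> [skip; by_cases hit : i = t] <;>
    (by_cases hjs : j = s <;> [skip; by_cases hjt : j = t]) <;>
    [skip; skip; rcases hx j hjs hjt with ⟨a1, a2, a3, a4⟩ | ⟨a1, a2, a3, a4⟩;
     skip; skip; rcases hx j hjs hjt with ⟨a1, a2, a3, a4⟩ | ⟨a1, a2, a3, a4⟩;
     rcases hx i his hit with ⟨b1, b2, b3, b4⟩ | ⟨b1, b2, b3, b4⟩;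
     rcases hx i his hit with ⟨b1, b2, b3, b4⟩ | ⟨b1, b2, b3, b4⟩; skip]
  all_goals
    try subst his
    try subst hit
    try subst hjs
    try subst hjt
    simp_all [crossFun, lowerMat, sub_dotProduct, Matrix.mulVec_sub, dotProduct_sub, eq_comm]
  all_goals first | exact mul_comm _ _ | (split_ifs <;> first | order | simp)

/-- The triangular half of the identity φ_β(𝐀) = Φ^L 𝐀 Φ^R, freed of μ. It extends from generators
because Φ^L multiplies up on the left and Φ^R on the right; for inverses the cocycle rule supplies
the inverse matrices. -/
theorem lowerMat_act (ε : CordAlg (Fin n) →ₐ[ℤ] K) (β : BraidGroup n) :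
    lowerMat (act ε β) = evalL ε β * lowerMat ε * evalR ε β := by
  have hR : ∀ (ε : CordAlg (Fin n) →ₐ[ℤ] K) a b,
      evalR ε (a * b) = evalR ε a * evalR (act ε a) b := by
    intro ε a b
    rw [← Matrix.transpose_inj, Matrix.transpose_mul]
    exact isCocycle_evalR_transpose.mul ε a b
  have hR1 : ∀ ε : CordAlg (Fin n) →ₐ[ℤ] K, evalR ε 1 = 1 := by
    intro ε
    rw [← Matrix.transpose_inj, Matrix.transpose_one]
    exact isCocycle_evalR_transpose.one ε
  induction β using braid_induction generalizing ε with
  | one => rw [isRightAction_act.one, isCocycle_evalL.one, hR1, one_mul, mul_one]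
  | of g => exact lowerMat_act_of ε g
  | mul a b ha hb =>
    rw [isRightAction_act.mul, hb, ha, isCocycle_evalL.mul, hR]
    simp only [mul_assoc]
  | inv a ha =>
    have h := ha (act ε a⁻¹)
    have h1 := isCocycle_evalL.mul ε a⁻¹ a
    have h2 := hR ε a⁻¹ a
    rw [← isRightAction_act.mul, inv_mul_cancel, isRightAction_act.one] at h
    rw [inv_mul_cancel, isCocycle_evalL.one] at h1
    rw [inv_mul_cancel, hR1] at h2
    have h1' := mul_eq_one_comm.1 h1.symm
    have h2' := mul_eq_one_comm.1 h2.symm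
    rw [h, ← mul_assoc, ← mul_assoc, h1', one_mul, mul_assoc, h2', mul_one]

theorem upperMat_act (ε : CordAlg (Fin n) →ₐ[ℤ] K) (β : BraidGroup n) :
    upperMat (act ε β) = evalL ε β * upperMat ε * evalR ε β := by
  rw [upperMat_eq, upperMat_eq, flip_act, lowerMat_act, evalR_eq, evalR_eq, flip_flip]
  simp only [Matrix.transpose_mul, mul_assoc, Matrix.transpose_transpose]

end triangular

/-! ### Block crossings -/

section block

variable {N : ℕ} {K : Type*} [CommRing K]

/-- The permutation of the strands in a crossing of the block of `a` strands starting at `m` with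
the next `l` strands. -/
def blockPerm (m a l i : ℕ) : ℕ :=
  if i < m then i else if i < m + l then i + a else if i < m + l + a then i - l else i

/-- The shape of `Φ^L` of a crossing of the block of `a` strands starting at `m` with the next `l`
strands: outside of the rows `m, …, m + l - 1` and columns `m, …, m + a - 1` it is a permutation
matrix. -/
def IsBlockCrossing (m a l : ℕ) (V : Matrix (Fin N) (Fin N) K) : Prop :=
  ∀ i j : Fin N, ¬ ((m ≤ i ∧ (i : ℕ) < m + l) ∧ m ≤ j ∧ (j : ℕ) < m + a) →
    V i j = if (j : ℕ) = blockPerm m a l i then 1 else 0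

/-- Used to multiply matrices that are permutation matrices up to unknown entries, provided the
other factor kills those entries in the column considered. -/
theorem mul_apply_of_row {A B : Matrix (Fin N) (Fin N) K} {i j y : Fin N} (hy : A i y = 1)
    (h : ∀ x, x ≠ y → A i x = 0 ∨ B x j = 0) : (A * B) i j = B y j := by
  rw [Matrix.mul_apply, Finset.sum_eq_single y, hy, one_mul]
  · intro x _ hx
    rcases h x hx with h | h <;> simp [h]
  · simp

theorem IsBlockCrossing.one (m a l : ℕ) (h : a = 0 ∨ l = 0) :
    IsBlockCrossing m a l (1 : Matrix (Fin N) (Fin N) K) := by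
  intro i j _
  have : blockPerm m a l i = i := by
    unfold blockPerm
    split_ifs <;> omega
  simp only [this, Matrix.one_apply, Fin.ext_iff, eq_comm]

theorem isBlockCrossing_sigma (ε : CordAlg (Fin N) →ₐ[ℤ] K) {m : ℕ} (hm : m + 1 < N) :
    IsBlockCrossing m 1 1 (evalL ε (sigma N m)) := by
  intro i j h
  have hp : blockPerm m 1 1 i =
      if (i : ℕ) = m then m + 1 else if (i : ℕ) = m + 1 then m else i := by
    unfold blockPerm
    split_ifs <;> omega
  rw [hp, sigma, dif_pos hm, evalL_of]
  simp only [Fin.ext_iff]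
  by_cases h1 : (i : ℕ) = m
  · have h2 : ¬ (j : ℕ) = m := fun h2 => h (by omega)
    simp [h1, h2, Pi.single_apply, Fin.ext_iff]
  · by_cases h2 : (i : ℕ) = m + 1 <;> simp [h1, h2, Pi.single_apply, Fin.ext_iff]

theorem isBlockCrossing_run (ε : CordAlg (Fin N) →ₐ[ℤ] K) (m l : ℕ) (h : m + l < N) :
    IsBlockCrossing m 1 l (evalL ε (run (sigma N) m l)) := by
  induction l with
  | zero =>
    rw [run, isCocycle_evalL.one]
    exact IsBlockCrossing.one _ _ _ (Or.inr rfl)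
  | succ l ih =>
    intro i j hij
    have hB := ih (by omega)
    have hA := isBlockCrossing_sigma (act ε (run (sigma N) m l)) (m := m + l) (by omega)
    have hi := i.2
    have hy : blockPerm (m + l) 1 1 i < N := by
      unfold blockPerm
      split_ifs <;> omega
    rw [run, isCocycle_evalL.mul, mul_apply_of_row (y := ⟨_, hy⟩)]
    · rw [hB _ _ ?_]
      · congr 2
        simp only [blockPerm]
        split_ifs <;> omega
      · simp only [blockPerm]
        split_ifs <;> omega
    · rw [hA _ _ ?_, if_pos rfl]
      simp only [blockPerm]
      split_ifs <;> omega
    · intro x hx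
      -- The only entry of the last generator's matrix off the permutation pattern. It meets row `m
      -- + l` of the shorter run, whose 1 is in column `m`; for this `i` that column is excluded by
      -- `hij`.
      by_cases hs : (i : ℕ) = m + l ∧ (x : ℕ) = m + l
      · right
        rw [hB _ _ (by omega), if_neg]
        simp only [blockPerm]
        split_ifs <;> omega
      · left
        rw [hA _ _ (by omega), if_neg]
        exact fun e => hx (Fin.ext e)

theorem isBlockCrossing_blockCross (ε : CordAlg (Fin N) →ₐ[ℤ] K) (m l a : ℕ)
    (h : m + a + l ≤ N) :
    IsBlockCrossing m a l (evalL ε (blockCross (sigma N) m l a)) := by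
  induction a generalizing ε with
  | zero =>
    rw [blockCross, isCocycle_evalL.one]
    exact IsBlockCrossing.one _ _ _ (Or.inl rfl)
  | succ a ih =>
    intro i j hij
    have hB := isBlockCrossing_run ε (m + a) l (by omega)
    have hA := ih (act ε (run (sigma N) (m + a) l)) (by omega)
    have hi := i.2
    have hy : blockPerm m a l i < N := by
      unfold blockPerm
      split_ifs <;> omega
    rw [blockCross, isCocycle_evalL.mul, mul_apply_of_row (y := ⟨_, hy⟩)]
    · rw [hB _ _ ?_]
      · congr 2
        simp only [blockPerm]
        split_ifs <;> omega
      · simp only [blockPerm]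
        split_ifs <;> omega
    · rw [hA _ _ ?_, if_pos rfl]
      simp only [blockPerm]
      split_ifs <;> omega
    · intro x hx
      -- Unknown entries of the smaller block crossing meet rows `x < m + a`, which the run starting
      -- at `m + a` fixes. They contribute only to columns inside the larger exceptional block.
      by_cases hs : (m ≤ i ∧ (i : ℕ) < m + l) ∧ m ≤ x ∧ (x : ℕ) < m + a
      · right
        rw [hB _ _ (by omega), if_neg]
        simp only [blockPerm]
        split_ifs <;> omega
      · left
        rw [hA _ _ hs, if_neg]
        exact fun e => hx (Fin.ext e)

end block

/-! ### Parallels -/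

section parallel

open scoped Kronecker

variable {k p : ℕ} {K : Type*} [CommRing K]

/-- The Kronecker product, with blocks of size `p`. -/
def kronMat (A : Matrix (Fin k) (Fin k) K) (B : Matrix (Fin p) (Fin p) K) :
    Matrix (Fin (k * p)) (Fin (k * p)) K :=
  (A ⊗ₖ B).submatrix finProdFinEquiv.symm finProdFinEquiv.symm

@[simp]
theorem kronMat_apply (A : Matrix (Fin k) (Fin k) K) (B : Matrix (Fin p) (Fin p) K)
    (x y : Fin k × Fin p) :
    kronMat A B (finProdFinEquiv x) (finProdFinEquiv y) = A x.1 y.1 * B x.2 y.2 := by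
  simp [kronMat, Matrix.kroneckerMap_apply]

theorem kronMat_mul (A A' : Matrix (Fin k) (Fin k) K) (B B' : Matrix (Fin p) (Fin p) K) :
    kronMat A B * kronMat A' B' = kronMat (A * A') (B * B') := by
  rw [kronMat, kronMat, kronMat, Matrix.submatrix_mul_equiv, Matrix.mul_kronecker_mul]

theorem kronMat_one :
    kronMat (1 : Matrix (Fin k) (Fin k) K) (1 : Matrix (Fin p) (Fin p) K) = 1 := by
  rw [kronMat, Matrix.one_kronecker_one, Matrix.submatrix_one_equiv]

theorem kronMat_transpose (A : Matrix (Fin k) (Fin k) K) (B : Matrix (Fin p) (Fin p) K) :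
    (kronMat A B).transpose = kronMat A.transpose B.transpose := rfl

theorem matrix_ext_prod {R : Type*} {A B : Matrix (Fin (k * p)) (Fin (k * p)) R}
    (h : ∀ x y : Fin k × Fin p, A (finProdFinEquiv x) (finProdFinEquiv y) =
      B (finProdFinEquiv x) (finProdFinEquiv y)) : A = B := by
  ext x y
  obtain ⟨x, rfl⟩ := finProdFinEquiv.surjective x
  obtain ⟨y, rfl⟩ := finProdFinEquiv.surjective y
  exact h x y

/-- The numbering of strands is lexicographic, block first. This is why Kronecker products of
triangular matrices are again triangular. -/
theorem finProdFinEquiv_lt {x y : Fin k × Fin p} :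
    finProdFinEquiv x < finProdFinEquiv y ↔ x.1 < y.1 ∨ x.1 = y.1 ∧ x.2 < y.2 := by
  obtain ⟨a, r⟩ := x
  obtain ⟨b, s⟩ := y
  have hr := r.2
  have hs := s.2
  simp only [Fin.lt_def, finProdFinEquiv_apply_val, Fin.ext_iff]
  rcases lt_trichotomy (a : ℕ) b with h | h | h
  · have := Nat.mul_le_mul_left p (Nat.succ_le_of_lt h)
    rw [Nat.mul_succ] at this
    omega
  · simp [h]
  · have := Nat.mul_le_mul_left p (Nat.succ_le_of_lt h)
    rw [Nat.mul_succ] at this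
    omega

/-- The homomorphism out of `𝒜_{kp}` whose triangular matrices are the Kronecker products of those
of homomorphisms out of `𝒜_k` and `𝒜_p`. -/
noncomputable def satelliteHom (c : CordAlg (Fin k) →ₐ[ℤ] K) (g : CordAlg (Fin p) →ₐ[ℤ] K) :
    CordAlg (Fin (k * p)) →ₐ[ℤ] K :=
  ofValues fun x y => if x < y then kronMat (upperMat c) (upperMat g) x y
    else kronMat (lowerMat c) (lowerMat g) x y

theorem flip_satelliteHom (c : CordAlg (Fin k) →ₐ[ℤ] K) (g : CordAlg (Fin p) →ₐ[ℤ] K) :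
    flip (satelliteHom c g) = satelliteHom (flip c) (flip g) := by
  refine cordHom_ext fun x y h => ?_
  rw [flip_cord, satelliteHom, satelliteHom, ofValues_cord _ h, ofValues_cord _ h.symm]
  have h1 : ∀ {n : ℕ} (c : CordAlg (Fin n) →ₐ[ℤ] K), upperMat (flip c) = (lowerMat c).transpose :=
    fun c => by rw [upperMat_eq, flip_flip]
  have h2 : ∀ {n : ℕ} (c : CordAlg (Fin n) →ₐ[ℤ] K), lowerMat (flip c) = (upperMat c).transpose :=
    fun c => by rw [upperMat_eq, Matrix.transpose_transpose]
  rw [h1, h1, h2, h2, ← kronMat_transpose, ← kronMat_transpose, Matrix.transpose_apply,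
    Matrix.transpose_apply]
  rcases lt_or_gt_of_ne h with h | h
  · rw [if_pos h, if_neg h.not_gt]
  · rw [if_neg h.not_gt, if_pos h]

theorem lowerMat_satelliteHom (c : CordAlg (Fin k) →ₐ[ℤ] K) (g : CordAlg (Fin p) →ₐ[ℤ] K) :
    lowerMat (satelliteHom c g) = kronMat (lowerMat c) (lowerMat g) := by
  ext x y
  rcases lt_trichotomy x y with h | h | h
  · rw [lowerMat_of_lt _ h]
    obtain ⟨x, rfl⟩ := finProdFinEquiv.surjective x
    obtain ⟨y, rfl⟩ := finProdFinEquiv.surjective y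
    rw [kronMat_apply]
    rcases finProdFinEquiv_lt.1 h with h | ⟨-, h⟩ <;> simp [lowerMat_of_lt _ h]
  · subst h
    obtain ⟨x, rfl⟩ := finProdFinEquiv.surjective x
    simp [lowerMat_self]
  · rw [lowerMat, Matrix.of_apply, if_pos h, satelliteHom, ofValues_cord _ h.ne', if_neg h.not_gt]

theorem upperMat_satelliteHom (c : CordAlg (Fin k) →ₐ[ℤ] K) (g : CordAlg (Fin p) →ₐ[ℤ] K) :
    upperMat (satelliteHom c g) = kronMat (upperMat c) (upperMat g) := by
  rw [upperMat_eq, upperMat_eq c, upperMat_eq g, flip_satelliteHom, lowerMat_satelliteHom,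
    kronMat_transpose]

theorem parallel_of (g : BraidGen k) :
    parallel k p (PresentedGroup.of g) = blockCross (sigma (k * p)) (g * p) p p :=
  braidLift_of _ _ _ _

theorem blockPerm_finProdFinEquiv (g : BraidGen k) (a : Fin k) (r : Fin p) :
    blockPerm (g * p) p p (finProdFinEquiv (a, r)) =
      finProdFinEquiv (Equiv.swap g.fst g.snd a, r) := by
  have hr := r.2
  have e1 : p * ((g : ℕ) + 1) = p * g + p := Nat.mul_succ _ _
  rw [Equiv.swap_apply_def]
  simp only [finProdFinEquiv_apply_val, blockPerm, mul_comm (g : ℕ) p, Fin.ext_iff]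
  rcases lt_or_ge (a : ℕ) g with h | h
  · have := Nat.mul_le_mul_left p (Nat.succ_le_of_lt h)
    rw [Nat.mul_succ] at this
    rw [if_pos (by omega), if_neg (by omega), if_neg (by omega)]
  rcases eq_or_lt_of_le h with h | h
  · rw [← h, if_neg (by omega), if_pos (by omega), if_pos rfl]
    change _ = (r : ℕ) + p * (g + 1)
    omega
  rcases eq_or_lt_of_le (Nat.succ_le_of_lt h) with h' | h'
  · rw [Nat.succ_eq_add_one] at h'
    rw [← h', if_neg (by omega), if_neg (by omega), if_pos (by omega), if_neg (by omega),
      if_pos rfl]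
    change _ = (r : ℕ) + p * g
    omega
  · have := Nat.mul_le_mul_left p (Nat.succ_le_of_lt h')
    rw [Nat.mul_succ, Nat.mul_succ] at this
    rw [if_neg (by omega), if_neg (by omega), if_neg (by omega), if_neg (by omega),
      if_neg (by omega)]

theorem evalL_of_apply_eq_swap (c : CordAlg (Fin k) →ₐ[ℤ] K) (g : BraidGen k) (a b : Fin k)
    (h : ¬ (a = g.fst ∧ b = g.fst)) :
    evalL c (PresentedGroup.of g) a b = if b = Equiv.swap g.fst g.snd a then 1 else 0 := by
  rw [evalL_of, Equiv.swap_apply_def]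
  split_ifs <;> simp_all

/-- The shape of `Φ^L` of the parallel of a generator, in terms of Kronecker products. -/
theorem exists_evalL_parallel_of (ε : CordAlg (Fin (k * p)) →ₐ[ℤ] K)
    (c : CordAlg (Fin k) →ₐ[ℤ] K) (g : BraidGen k) :
    ∃ Y : Matrix (Fin p) (Fin p) K, evalL ε (parallel k p (PresentedGroup.of g)) =
      kronMat (evalL c (PresentedGroup.of g)) 1 + kronMat (Matrix.single g.fst g.fst 1) Y := by
  have hN : (g : ℕ) * p + p + p ≤ k * p := by
    have := Nat.mul_le_mul_right p (show (g : ℕ) + 2 ≤ k from g.2)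
    linarith
  have hV := isBlockCrossing_blockCross ε (g * p) p p hN
  rw [parallel_of]
  set V := evalL ε (blockCross (sigma (k * p)) (g * p) p p)
  -- `Y` is the discrepancy in the exceptional block: the entry of Φ^L of the generator at (`g.fst`,
  -- `g.fst`) is `-c (cord g.snd g.fst)`, and subtracting it gives the plus sign.
  refine ⟨Matrix.of fun r s => V (finProdFinEquiv (g.fst, r)) (finProdFinEquiv (g.fst, s)) +
    c (cord g.snd g.fst) * (1 : Matrix (Fin p) (Fin p) K) r s, matrix_ext_prod ?_⟩
  rintro ⟨a, r⟩ ⟨b, s⟩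
  rw [Matrix.add_apply, kronMat_apply, kronMat_apply]
  have hne : g.fst ≠ g.snd := by simp
  by_cases h : a = g.fst ∧ b = g.fst
  · obtain ⟨rfl, rfl⟩ := h
    simp [evalL_of, hne]
  · have hr := r.2
    have hs := s.2
    have key : ∀ (x : Fin k) (t : Fin p), g * p ≤ (finProdFinEquiv (x, t) : ℕ) →
        (finProdFinEquiv (x, t) : ℕ) < g * p + p → x = g.fst := by
      intro x t h1 h2
      have ht := t.2
      rw [finProdFinEquiv_apply_val] at h1 h2
      apply Fin.ext
      change (x : ℕ) = g
      dsimp only at h1 h2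
      nlinarith
    rw [hV _ _ fun h' => h ⟨key _ _ h'.1.1 h'.1.2, key _ _ h'.2.1 h'.2.2⟩,
      blockPerm_finProdFinEquiv, evalL_of_apply_eq_swap _ _ _ _ h]
    simp only [← Fin.ext_iff, finProdFinEquiv.injective.eq_iff, Prod.mk.injEq, Matrix.one_apply]
    rw [Matrix.single_apply_of_ne _ _ _ _ _ (by tauto), zero_mul, add_zero]
    by_cases h1 : b = Equiv.swap g.fst g.snd a <;> by_cases h2 : r = s <;>
      simp [h1, h2, eq_comm]

/-- Up to unknown blocks `Y` and `Z`, Φ^L and Φ^R of the block crossing have the desired Kronecker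
form. Substituting this into `lowerMat_act` and reading off the block (`i.fst`, `i.snd`), which is
above the diagonal and hence zero, leaves only `Y * lowerMat g`. Invertibility of the unitriangular
factor gives `Y = 0`. -/
theorem evalL_parallel_of (c : CordAlg (Fin k) →ₐ[ℤ] K) (g : CordAlg (Fin p) →ₐ[ℤ] K)
    (i : BraidGen k) :
    evalL (satelliteHom c g) (parallel k p (PresentedGroup.of i)) =
      kronMat (evalL c (PresentedGroup.of i)) 1 := by
  obtain ⟨Y, hY⟩ := exists_evalL_parallel_of (satelliteHom c g) c i
  obtain ⟨Z, hZ⟩ := exists_evalL_parallel_of (flip (satelliteHom c g)) (flip c) i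
  have h := lowerMat_act (satelliteHom c g) (parallel k p (PresentedGroup.of i))
  have hc := lowerMat_act c (PresentedGroup.of i)
  have hlt : i.fst < i.snd := by simp [Fin.lt_def]
  rw [evalR_eq, hY, hZ, lowerMat_satelliteHom, Matrix.transpose_add, kronMat_transpose,
    kronMat_transpose, ← evalR_eq] at h
  simp only [add_mul, mul_add, kronMat_mul, ← hc, Matrix.transpose_single] at h
  have hYL : Y * lowerMat g = 0 := by
    ext r s
    have h' := congrFun (congrFun h (finProdFinEquiv (i.fst, r))) (finProdFinEquiv (i.snd, s))
    simp only [Matrix.add_apply, kronMat_apply] at h'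
    -- The coefficient of `Y * lowerMat g` in this block. Column `i.snd` of Φ^R is the unit vector
    -- at `i.fst`, so the coefficient is a diagonal entry of `lowerMat c`. The terms with `Z` are
    -- supported in column block `i.fst` and vanish here.
    have h1 : (Matrix.single i.fst i.fst 1 * lowerMat c * evalR c (PresentedGroup.of i) :
        Matrix (Fin k) (Fin k) K) i.fst i.snd = 1 := by
      rw [mul_assoc, Matrix.single_mul_apply_same, one_mul]
      change lowerMat c i.fst ⬝ᵥ (evalR c (PresentedGroup.of i)).transpose i.snd = 1
      rw [evalR_of, if_neg hlt.ne', if_pos rfl, dotProduct_single_one, lowerMat_self]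
    have hxy : finProdFinEquiv (i.fst, r) < finProdFinEquiv (i.snd, s) :=
      finProdFinEquiv_lt.2 (Or.inl hlt)
    rw [h1, lowerMat_of_lt _ hlt, lowerMat_of_lt _ hxy,
      Matrix.mul_single_apply_of_ne _ _ _ _ _ hlt.ne',
      Matrix.mul_single_apply_of_ne _ _ _ _ _ hlt.ne'] at h'
    simpa using h'.symm
  have hu : IsUnit (lowerMat g) := by
    rw [Matrix.isUnit_iff_isUnit_det, det_lowerMat]
    exact isUnit_one
  have hY0 : Y = 0 := hu.mul_left_eq_zero.1 hYL
  rw [hY, hY0]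
  simp [kronMat]

theorem evalR_parallel_of (c : CordAlg (Fin k) →ₐ[ℤ] K) (g : CordAlg (Fin p) →ₐ[ℤ] K)
    (i : BraidGen k) :
    evalR (satelliteHom c g) (parallel k p (PresentedGroup.of i)) =
      kronMat (evalR c (PresentedGroup.of i)) 1 := by
  rw [evalR_eq, flip_satelliteHom, evalL_parallel_of, kronMat_transpose, ← evalR_eq,
    Matrix.transpose_one]

/-- On a generator, both triangular matrices transform by Φ^L ⊗ 1 and Φ^R ⊗ 1, so the Kronecker form
persists and only the factor `c` moves. A homomorphism is determined by its two triangles. -/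
theorem satelliteHom_act (c : CordAlg (Fin k) →ₐ[ℤ] K) (g : CordAlg (Fin p) →ₐ[ℤ] K)
    (β : BraidGroup k) :
    satelliteHom (act c β) g = act (satelliteHom c g) (parallel k p β) := by
  refine isRightAction_act.equivariant (F := fun c => satelliteHom c g)
    (act' := fun ε β => act ε (parallel k p β)) ⟨fun ε => ?_, fun ε a b => ?_⟩
    (fun c i => ?_) β c
  · rw [map_one, isRightAction_act.one]
  · rw [map_mul, isRightAction_act.mul]
  · apply eq_of_lowerMat_eq_of_upperMat_eq
    · rw [lowerMat_satelliteHom, lowerMat_act, lowerMat_act, evalL_parallel_of, evalR_parallel_of,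
        lowerMat_satelliteHom, kronMat_mul, kronMat_mul, one_mul, mul_one]
    · rw [upperMat_satelliteHom, upperMat_act, upperMat_act, evalL_parallel_of, evalR_parallel_of,
        upperMat_satelliteHom, kronMat_mul, kronMat_mul, one_mul, mul_one]

theorem evalL_parallel (c : CordAlg (Fin k) →ₐ[ℤ] K) (g : CordAlg (Fin p) →ₐ[ℤ] K)
    (β : BraidGroup k) :
    evalL (satelliteHom c g) (parallel k p β) = kronMat (evalL c β) 1 := by
  refine IsCocycle.ext isRightAction_act (v := fun c β => evalL (satelliteHom c g) (parallel k p β))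
    (w := fun c β => kronMat (evalL c β) 1) ⟨fun c => ?_, fun c a b => ?_⟩
    ⟨fun c => ?_, fun c a b => ?_⟩ (fun c i => evalL_parallel_of c g i) β c
  · rw [map_one, isCocycle_evalL.one]
  · rw [map_mul, isCocycle_evalL.mul, satelliteHom_act]
  · rw [isCocycle_evalL.one, kronMat_one]
  · rw [isCocycle_evalL.mul, kronMat_mul, one_mul]

end parallel

/-! ### Inclusions of braid groups -/

section inclusion

variable {n m : ℕ} {K : Type*} [CommRing K]

/-- The restriction of a homomorphism to the subalgebra on the first `n` indices. -/
noncomputable def restrictHom (h : n ≤ m) (ε : CordAlg (Fin m) →ₐ[ℤ] K) :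
    CordAlg (Fin n) →ₐ[ℤ] K :=
  ofValues fun i j => ε (cord (Fin.castLE h i) (Fin.castLE h j))

theorem restrictHom_cord (h : n ≤ m) (ε : CordAlg (Fin m) →ₐ[ℤ] K) (i j : Fin n) :
    restrictHom h ε (cord i j) = ε (cord (Fin.castLE h i) (Fin.castLE h j)) := by
  by_cases hij : i = j
  · simp [hij, cord]
  · exact ofValues_cord _ hij

theorem braidIncl_of (h : n ≤ m) (g : BraidGen n) :
    braidIncl h (PresentedGroup.of g) = PresentedGroup.of ⟨g, g.2.trans_le h⟩ := by
  rw [braidIncl, braidLift_of, sigma, dif_pos (g.2.trans_le h)]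

theorem isRightAction_act_comp (f : BraidGroup n →* BraidGroup m) :
    IsRightAction fun (ε : CordAlg (Fin m) →ₐ[ℤ] K) β => act ε (f β) :=
  ⟨fun ε => by rw [map_one, isRightAction_act.one], fun ε a b => by
    rw [map_mul, isRightAction_act.mul]⟩

theorem restrictHom_act (h : n ≤ m) (β : BraidGroup n) (ε : CordAlg (Fin m) →ₐ[ℤ] K) :
    restrictHom h (act ε (braidIncl h β)) = act (restrictHom h ε) β := by
  refine (isRightAction_act_comp (braidIncl h)).equivariant isRightAction_act (restrictHom h)
    (fun ε g => cordHom_ext fun i j hij => ?_) β ε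
  have hs : Fin.castLE h g.fst = BraidGen.fst ⟨g, g.2.trans_le h⟩ := rfl
  have ht : Fin.castLE h g.snd = BraidGen.snd ⟨g, g.2.trans_le h⟩ := rfl
  rw [restrictHom_cord, braidIncl_of, act_of_cord _ _ hij,
    act_of_cord _ _ ((Fin.castLE_injective h).ne hij), ← hs, ← ht]
  simp only [crossFun, (Fin.castLE_injective h).eq_iff]
  split_ifs <;> simp [restrictHom_cord]

/-- The first `n` of `m` indices and the others. -/
def splitEquiv (h : n ≤ m) : Fin n ⊕ Fin (m - n) ≃ Fin m :=
  finSumFinEquiv.trans (finCongr (by omega))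

theorem splitEquiv_inl (h : n ≤ m) (i : Fin n) : splitEquiv h (Sum.inl i) = Fin.castLE h i := by
  ext; simp [splitEquiv]

theorem splitEquiv_inr (h : n ≤ m) (i : Fin (m - n)) : (splitEquiv h (Sum.inr i) : ℕ) = n + i := by
  simp [splitEquiv]

/-- A matrix, extended by an identity block. -/
def extendOne (h : n ≤ m) (M : Matrix (Fin n) (Fin n) K) : Matrix (Fin m) (Fin m) K :=
  (Matrix.fromBlocks M 0 0 1).submatrix (splitEquiv h).symm (splitEquiv h).symm

theorem extendOne_mul (h : n ≤ m) (M N : Matrix (Fin n) (Fin n) K) :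
    extendOne h M * extendOne h N = extendOne h (M * N) := by
  rw [extendOne, extendOne, extendOne, Matrix.submatrix_mul_equiv, Matrix.fromBlocks_multiply]
  simp

theorem extendOne_one (h : n ≤ m) : extendOne h (1 : Matrix (Fin n) (Fin n) K) = 1 := by
  rw [extendOne, Matrix.fromBlocks_one, Matrix.submatrix_one_equiv]

theorem extendOne_diagonal (h : n ≤ m) (d : Fin n → K) :
    extendOne h (Matrix.diagonal d) =
      Matrix.diagonal fun x : Fin m => if hx : (x : ℕ) < n then d ⟨x, hx⟩ else 1 := by
  rw [extendOne, ← Matrix.diagonal_one, Matrix.fromBlocks_diagonal,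
    Matrix.submatrix_diagonal_equiv]
  congr 1
  funext x
  obtain ⟨x, rfl⟩ := (splitEquiv h).surjective x
  rcases x with i | i
  · rw [Function.comp_apply, Equiv.symm_apply_apply]
    simp [splitEquiv_inl]
  · simp [splitEquiv_inr]

/-- The included braid fixes the remaining strands, and its coefficients involve only generators
with both indices among the first `n`. -/
theorem evalL_braidIncl (h : n ≤ m) (β : BraidGroup n) (ε : CordAlg (Fin m) →ₐ[ℤ] K) :
    evalL ε (braidIncl h β) = extendOne h (evalL (restrictHom h ε) β) := by
  refine IsCocycle.ext (isRightAction_act_comp (braidIncl h))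
    (v := fun ε β => evalL ε (braidIncl h β))
    (w := fun ε β => extendOne h (evalL (restrictHom h ε) β)) ⟨fun ε => ?_, fun ε a b => ?_⟩
    ⟨fun ε => ?_, fun ε a b => ?_⟩ (fun ε g => ?_) β ε
  · rw [map_one, isCocycle_evalL.one]
  · rw [map_mul, isCocycle_evalL.mul]
  · rw [isCocycle_evalL.one, extendOne_one]
  · rw [isCocycle_evalL.mul, restrictHom_act, extendOne_mul]
  · have hs : Fin.castLE h g.fst = BraidGen.fst ⟨g, g.2.trans_le h⟩ := rfl
    have ht : Fin.castLE h g.snd = BraidGen.snd ⟨g, g.2.trans_le h⟩ := rfl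
    have hne : ∀ i j, Fin.castLE h i ≠ splitEquiv h (Sum.inr j) := by
      intro i j e
      have := congrArg Fin.val e
      rw [splitEquiv_inr, Fin.val_castLE] at this
      omega
    ext x y
    obtain ⟨x, rfl⟩ := (splitEquiv h).surjective x
    obtain ⟨y, rfl⟩ := (splitEquiv h).surjective y
    rw [braidIncl_of, evalL_of, ← hs, ← ht, extendOne, Matrix.submatrix_apply,
      Equiv.symm_apply_apply, Equiv.symm_apply_apply]
    rcases x with i | i <;> rcases y with j | j <;>
      simp only [splitEquiv_inl, (Fin.castLE_injective h).eq_iff, (hne _ _).symm, if_false,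
        Matrix.fromBlocks_apply₁₁, Matrix.fromBlocks_apply₁₂, Matrix.fromBlocks_apply₂₁,
        Matrix.fromBlocks_apply₂₂, evalL_of]
    · split_ifs <;> simp only [Pi.sub_apply, Pi.single_apply, (Fin.castLE_injective h).eq_iff,
        restrictHom_cord]
    · split_ifs <;> simp only [Pi.sub_apply, Pi.single_apply, (hne _ _).symm, if_false, sub_zero,
        Matrix.zero_apply]
    · simp [hne]
    · simp [Pi.single_apply, Matrix.one_apply, eq_comm]

end inclusion

/-! ### Rescaling -/

section rescale

variable {n : ℕ} {K : Type*} [CommRing K]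

/-- The homomorphism `ε` with its values on the `a_{ij}` multiplied by `s_i s_j⁻¹`. -/
noncomputable def rescale (s : Fin n → Kˣ) (ε : CordAlg (Fin n) →ₐ[ℤ] K) :
    CordAlg (Fin n) →ₐ[ℤ] K :=
  ofValues fun i j => s i * ε (cord i j) * ((s j)⁻¹ : Kˣ)

theorem rescale_cord (s : Fin n → Kˣ) (ε : CordAlg (Fin n) →ₐ[ℤ] K) (i j : Fin n) :
    rescale s ε (cord i j) = s i * ε (cord i j) * ((s j)⁻¹ : Kˣ) := by
  by_cases h : i = j
  · simp [h, cord]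
  · exact ofValues_cord _ h

theorem flip_rescale (s : Fin n → Kˣ) (ε : CordAlg (Fin n) →ₐ[ℤ] K) :
    flip (rescale s ε) = rescale s⁻¹ (flip ε) := by
  refine cordHom_ext fun i j _ => ?_
  rw [flip_cord, rescale_cord, rescale_cord, flip_cord, Pi.inv_apply, Pi.inv_apply, inv_inv]
  ring

theorem braidPerm_of (g : BraidGen n) :
    braidPerm n (PresentedGroup.of g) = Equiv.swap g.fst g.snd :=
  braidLift_of _ _ _ _

/-- The action on homomorphisms together with a labelling of the strands. -/
noncomputable def actLabelled (x : (CordAlg (Fin n) →ₐ[ℤ] K) × (Fin n → Kˣ))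
    (β : BraidGroup n) : (CordAlg (Fin n) →ₐ[ℤ] K) × (Fin n → Kˣ) :=
  (act x.1 β, x.2 ∘ braidPerm n β)

theorem isRightAction_actLabelled : IsRightAction (actLabelled (n := n) (K := K)) where
  one x := by simp [actLabelled, isRightAction_act.one]
  mul x a b := by
    simp [actLabelled, isRightAction_act.mul, Function.comp_assoc, Equiv.Perm.coe_mul]

/-- Labels travel with the strands. Every term in the image of a_{ij} is a path between the same two
indices, so its inner labels cancel and its end labels are those of i and j after permutation. -/
theorem rescale_act (s : Fin n → Kˣ) (ε : CordAlg (Fin n) →ₐ[ℤ] K) (β : BraidGroup n) :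
    rescale (s ∘ braidPerm n β) (act ε β) = act (rescale s ε) β := by
  refine isRightAction_actLabelled.equivariant isRightAction_act (fun x => rescale x.2 x.1)
    (fun ⟨ε, s⟩ g => cordHom_ext fun i j hij => ?_) β (ε, s)
  simp only [actLabelled]
  rw [rescale_cord, act_of_cord _ _ hij, act_of_cord _ _ hij, braidPerm_of]
  simp only [crossFun, Function.comp_apply, Equiv.swap_apply_def]
  split_ifs <;> simp_all [rescale_cord, mul_sub, sub_mul]
  · linear_combination (-(s g.snd * ε (cord g.snd g.fst) * ε (cord g.fst j) * ((s j)⁻¹ : Kˣ))) *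
      Units.inv_mul (s g.fst)
  · linear_combination (-(s i * ε (cord i g.fst) * ε (cord g.fst g.snd) * ((s g.snd)⁻¹ : Kˣ))) *
      Units.inv_mul (s g.fst)

/-- A change of gauge, twisted by the permutation. The twist is what allows the diagonal entries to
change, where an honest conjugation would preserve them. -/
theorem evalL_rescale (s : Fin n → Kˣ) (ε : CordAlg (Fin n) →ₐ[ℤ] K) (β : BraidGroup n) :
    evalL (rescale s ε) β = Matrix.diagonal (fun i => (s (braidPerm n β i) : K)) * evalL ε β *
      Matrix.diagonal fun i => (((s i)⁻¹ : Kˣ) : K) := by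
  refine IsCocycle.ext isRightAction_actLabelled (v := fun x β => evalL (rescale x.2 x.1) β)
    (w := fun x β => Matrix.diagonal (fun i => (x.2 (braidPerm n β i) : K)) * evalL x.1 β *
      Matrix.diagonal fun i => (((x.2 i)⁻¹ : Kˣ) : K)) ⟨fun x => ?_, fun x a b => ?_⟩
    ⟨fun x => ?_, fun x a b => ?_⟩ (fun ⟨ε, s⟩ g => ?_) β (ε, s)
  · rw [isCocycle_evalL.one]
  · rw [isCocycle_evalL.mul, ← rescale_act]
    rfl
  · rw [map_one, isCocycle_evalL.one, mul_one, Matrix.diagonal_mul_diagonal]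
    simp
  -- The labels left by the first braid are those with which the second one starts, so the inner
  -- diagonal factors telescope.
  · have h : Matrix.diagonal (fun i => ((((actLabelled x a).2 i)⁻¹ : Kˣ) : K)) *
        Matrix.diagonal (fun i => (x.2 (braidPerm n a i) : K)) = 1 := by
      rw [Matrix.diagonal_mul_diagonal]
      simp [actLabelled]
    rw [isCocycle_evalL.mul]
    simp only [mul_assoc]
    rw [← mul_assoc (Matrix.diagonal _) (Matrix.diagonal _) (evalL x.1 a * _), h, one_mul]
    simp [actLabelled]
  · ext i j
    rw [Matrix.mul_diagonal, Matrix.diagonal_mul, evalL_of, evalL_of, braidPerm_of,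
      Equiv.swap_apply_def, rescale_cord]
    split_ifs <;> simp_all [Pi.single_apply, mul_sub, sub_mul]

/-- A function with product `1` on a cycle is a coboundary. -/
theorem exists_mul_inv_eq_of_isCycleOn {G : Type*} [CommGroup G] (hn : 0 < n)
    {π : Equiv.Perm (Fin n)} (hπ : π.IsCycleOn Set.univ) (q : Fin n → G) (hq : ∏ i, q i = 1) :
    ∃ s : Fin n → G, ∀ i, s (π i) * (s i)⁻¹ = q i := by
  have hπ' : π.IsCycleOn (Finset.univ : Finset (Fin n)) := by simpa using hπ
  have hu : ∀ x : Fin n, x ∈ (Finset.univ : Finset (Fin n)) := Finset.mem_univ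
  have hex : ∀ x, ∃ j < n, (π ^ j) ⟨0, hn⟩ = x := fun x => by
    simpa using hπ'.exists_pow_eq (hu ⟨0, hn⟩) (hu x)
  have hinj : ∀ a b, a < n → b < n → (π ^ a) ⟨0, hn⟩ = (π ^ b) ⟨0, hn⟩ → a = b := by
    intro a b ha hb h
    have := (hπ'.pow_apply_eq_pow_apply (hu ⟨0, hn⟩)).1 h
    rw [Finset.card_univ, Fintype.card_fin] at this
    exact this.eq_of_lt_of_lt ha hb
  have hprod : ∏ l ∈ Finset.range n, q ((π ^ l) ⟨0, hn⟩) = 1 := by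
    rw [← hq]
    refine Finset.prod_nbij (fun l => (π ^ l) ⟨0, hn⟩) (fun _ _ => Finset.mem_univ _) ?_ ?_
      fun _ _ => rfl
    · intro a ha b hb h
      exact hinj a b (by simpa using ha) (by simpa using hb) h
    · intro x _
      obtain ⟨j, hj, rfl⟩ := hex x
      exact ⟨j, by simpa using hj, rfl⟩
  choose j hjn hj using hex
  -- The primitive of `q` along the cycle starting at 0, where `j x` is the number of steps to `x`.
  -- It is consistent at the step returning to 0 because the product over the whole cycle is 1.
  refine ⟨fun x => ∏ l ∈ Finset.range (j x), q ((π ^ l) ⟨0, hn⟩), fun x => ?_⟩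
  have hs : (π ^ (j x + 1)) ⟨0, hn⟩ = π x := by rw [pow_succ', Equiv.Perm.mul_apply, hj]
  rw [mul_inv_eq_iff_eq_mul]
  beta_reduce
  rcases eq_or_lt_of_le (Nat.succ_le_of_lt (hjn x)) with h | h
  · rw [Nat.succ_eq_add_one] at h
    have h0 : j (π x) = 0 := by
      refine hinj _ _ (hjn _) hn ?_
      rw [hj, ← hs, h, pow_zero]
      simpa using hπ'.pow_card_apply (hu ⟨0, hn⟩)
    rw [h0, Finset.prod_range_zero, ← hprod,
      show Finset.range n = Finset.range (j x + 1) by rw [h], Finset.prod_range_succ, hj, mul_comm]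
  · have h0 : j (π x) = j x + 1 := hinj _ _ (hjn _) h (by rw [hj, hs])
    rw [h0, Finset.prod_range_succ, hj, mul_comm]

end rescale

/-! ### Augmentations of maximal rank -/

section diagonal

variable {n : ℕ} {K : Type*} [CommRing K]

/-- `ε` maps `Φ^L_β` to the diagonal matrix `d` and `Φ^R_β` to its inverse. -/
def IsDiagonal (ε : CordAlg (Fin n) →ₐ[ℤ] K) (β : BraidGroup n) (d : Fin n → Kˣ) : Prop :=
  evalL ε β = Matrix.diagonal (fun i => (d i : K)) ∧
    evalL (flip ε) β = Matrix.diagonal fun i => (((d i)⁻¹ : Kˣ) : K)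

theorem IsDiagonal.evalR {ε : CordAlg (Fin n) →ₐ[ℤ] K} {β : BraidGroup n} {d : Fin n → Kˣ}
    (h : IsDiagonal ε β d) : evalR ε β = Matrix.diagonal fun i => (((d i)⁻¹ : Kˣ) : K) := by
  rw [evalR_eq, h.2, Matrix.diagonal_transpose]

/-- The diagonal `(u, 1, …, 1)`. -/
def headDiag (n : ℕ) {G : Type*} [One G] (u : G) (i : Fin n) : G := if (i : ℕ) = 0 then u else 1

theorem prod_headDiag {G : Type*} [CommMonoid G] (hn : 0 < n) (u : G) :
    ∏ i, headDiag n u i = u := by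
  rw [Finset.prod_eq_single ⟨0, hn⟩]
  · simp [headDiag]
  · intro i _ hi
    simp only [ne_eq, Fin.ext_iff] at hi
    simp [headDiag, hi]
  · simp

theorem headDiag_inv {G : Type*} [Group G] (u : G) (i : Fin n) :
    (headDiag n u i)⁻¹ = headDiag n u⁻¹ i := by
  unfold headDiag
  split_ifs <;> simp

theorem IsDiagonal.exists_rescale (hn : 0 < n) {ε : CordAlg (Fin n) →ₐ[ℤ] K} {β : BraidGroup n}
    {d d' : Fin n → Kˣ} (h : IsDiagonal ε β d) (hβ : ClosureIsKnot β)
    (hd : ∏ i, d i = ∏ i, d' i) : ∃ s, IsDiagonal (rescale s ε) β d' := by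
  obtain ⟨s, hs⟩ := exists_mul_inv_eq_of_isCycleOn hn hβ.2 (fun i => d' i * (d i)⁻¹) (by
    rw [Finset.prod_mul_distrib, Finset.prod_inv_distrib, hd, mul_inv_cancel])
  have hs' : ∀ i, d' i = s (braidPerm n β i) * d i * (s i)⁻¹ := fun i => by
    rw [mul_right_comm, hs, inv_mul_cancel_right]
  refine ⟨s, ?_, ?_⟩
  · rw [evalL_rescale, h.1, Matrix.diagonal_mul_diagonal, Matrix.diagonal_mul_diagonal]
    simp only [hs', Units.val_mul]
  · rw [flip_rescale, evalL_rescale, h.2, Matrix.diagonal_mul_diagonal,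
      Matrix.diagonal_mul_diagonal]
    congr 1
    funext i
    rw [hs', ← Units.val_mul, ← Units.val_mul]
    congr 1
    simp only [Pi.inv_apply, mul_inv, inv_inv]

end diagonal

section criterion

variable {n : ℕ}

/-- The restriction of a homomorphism out of `𝒜_n ⊗ R₀` to `𝒜_n`. -/
noncomputable def coeffHom (ε : CordAlgR n →+* ℂ) : CordAlg (Fin n) →ₐ[ℤ] ℂ :=
  (ε.comp Algebra.TensorProduct.includeLeftRingHom).toIntAlgHom

theorem coeffHom_apply (ε : CordAlgR n →+* ℂ) (x : CordAlg (Fin n)) :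
    coeffHom ε x = ε (x ⊗ₜ[ℤ] 1) := rfl

theorem map_extend_PhiL (ε : CordAlgR n →+* ℂ) (β : BraidGroup n) :
    (extend (PhiL β)).map ε = evalL (coeffHom ε) β := rfl

theorem map_extend_PhiR (ε : CordAlgR n →+* ℂ) (β : BraidGroup n) :
    (extend (PhiR β)).map ε = evalR (coeffHom ε) β := rfl

/-- The value of a homomorphism on a Laurent monomial. -/
noncomputable def laurentUnit (ε : CordAlgR n →+* ℂ) (a b : ℤ) : ℂˣ where
  val := ε (1 ⊗ₜ[ℤ] laurent a b)
  inv := ε (1 ⊗ₜ[ℤ] laurent (-a) (-b))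
  val_inv := by
    rw [← map_mul, Algebra.TensorProduct.tmul_mul_tmul, laurent, laurent,
      AddMonoidAlgebra.single_mul_single]
    simp [← Prod.zero_eq_mk, ← AddMonoidAlgebra.one_def, ← Algebra.TensorProduct.one_def]
  inv_val := by
    rw [← map_mul, Algebra.TensorProduct.tmul_mul_tmul, laurent, laurent,
      AddMonoidAlgebra.single_mul_single]
    simp [← Prod.zero_eq_mk, ← AddMonoidAlgebra.one_def, ← Algebra.TensorProduct.one_def]

theorem map_matLambda (ε : CordAlgR n →+* ℂ) (β : BraidGroup n) :
    (matLambda β).map ε =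
      Matrix.diagonal fun i => ((headDiag n (laurentUnit ε 1 (writhe β)) i : ℂˣ) : ℂ) := by
  rw [matLambda, Matrix.diagonal_map (map_zero ε)]
  congr 1
  funext i
  simp only [headDiag]
  split_ifs
  · rfl
  · rw [← Algebra.TensorProduct.one_def, map_one, Units.val_one]

theorem map_matLambdaInv (ε : CordAlgR n →+* ℂ) (β : BraidGroup n) :
    (matLambdaInv β).map ε =
      Matrix.diagonal fun i => (((headDiag n (laurentUnit ε 1 (writhe β)) i)⁻¹ : ℂˣ) : ℂ) := by
  rw [matLambdaInv, Matrix.diagonal_map (map_zero ε)]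
  congr 1
  funext i
  rw [headDiag_inv]
  simp only [headDiag]
  split_ifs
  · rfl
  · rw [← Algebra.TensorProduct.one_def, map_one, Units.val_one]

/-- The kernel of `ε` is a two-sided ideal, so vanishing on the generators of `augIdeal β` suffices.
-/
theorem isAugmentation_iff (β : BraidGroup n) (ε : CordAlgR n →+* ℂ) :
    IsAugmentation β ε ↔
      (matA n).map ε = (matLambda β).map ε * evalL (coeffHom ε) β * (matA n).map ε ∧
      (matA n).map ε = (matA n).map ε * evalR (coeffHom ε) β * (matLambdaInv β).map ε := by
  have hL : (matA n - matLambda β * extend (PhiL β) * matA n).map ε = (matA n).map ε -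
      (matLambda β).map ε * evalL (coeffHom ε) β * (matA n).map ε := by
    rw [Matrix.map_sub _ (map_sub ε), Matrix.map_mul, Matrix.map_mul, map_extend_PhiL]
  have hR : (matA n - matA n * extend (PhiR β) * matLambdaInv β).map ε = (matA n).map ε -
      (matA n).map ε * evalR (coeffHom ε) β * (matLambdaInv β).map ε := by
    rw [Matrix.map_sub _ (map_sub ε), Matrix.map_mul, Matrix.map_mul, map_extend_PhiR]
  rw [← sub_eq_zero, ← hL, ← sub_eq_zero (b := _ * _ * Matrix.map (matLambdaInv β) ε), ← hR]
  constructor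
  · intro h
    constructor
    · ext i j
      exact h _ (TwoSidedIdeal.subset_span (Or.inl ⟨i, j, rfl⟩))
    · ext i j
      exact h _ (TwoSidedIdeal.subset_span (Or.inr ⟨i, j, rfl⟩))
  · rintro ⟨h1, h2⟩ x hx
    have : augIdeal β ≤ TwoSidedIdeal.ker ε := by
      refine TwoSidedIdeal.span_le.2 ?_
      rintro x (⟨i, j, rfl⟩ | ⟨i, j, rfl⟩)
      · exact (TwoSidedIdeal.mem_ker ε).2 (congrFun (congrFun h1 i) j)
      · exact (TwoSidedIdeal.mem_ker ε).2 (congrFun (congrFun h2 i) j)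
    exact (TwoSidedIdeal.mem_ker ε).1 (this hx)

theorem isUnit_of_rank_eq {M : Matrix (Fin n) (Fin n) ℂ} (h : M.rank = n) : IsUnit M := by
  rw [← Matrix.linearIndependent_cols_iff_isUnit, linearIndependent_iff_card_eq_finrank_span,
    Set.finrank, ← Matrix.rank_eq_finrank_span_cols, h, Fintype.card_fin]

/-- At full rank ε(𝐀) is invertible; cancelling it leaves 𝚲Φ^L = 1 = Φ^R𝚲⁻¹, so `c` is the inverse
of ε(λμ^ω). -/
theorem exists_isDiagonal_of_ar_eq (hn : 0 < n) {β : BraidGroup n} (h : ar β = n) :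
    ∃ (ε : CordAlg (Fin n) →ₐ[ℤ] ℂ) (c : ℂˣ), IsDiagonal ε β (headDiag n c) := by
  -- The supremum of the empty set is 0 by convention, which `0 < n` excludes; hence the maximum is
  -- attained.
  have hne : (augRanks β).Nonempty := by
    by_contra hne
    rw [Set.not_nonempty_iff_eq_empty] at hne
    rw [ar, hne, csSup_empty] at h
    exact hn.ne h
  obtain ⟨ε, haug, -, hr⟩ := Nat.sSup_mem hne (bddAbove_augRanks β)
  have hu : IsUnit ((matA n).map ε) := isUnit_of_rank_eq (hr.trans h)
  obtain ⟨hL, hR⟩ := (isAugmentation_iff β ε).1 haug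
  refine ⟨coeffHom ε, (laurentUnit ε 1 (writhe β))⁻¹, ?_, ?_⟩
  · have h1 := hu.mul_right_cancel ((one_mul _).trans hL)
    rw [map_matLambda] at h1
    refine (left_inv_eq_right_inv ?_ h1.symm).symm
    rw [Matrix.diagonal_mul_diagonal, ← Matrix.diagonal_one]
    simp [← headDiag_inv]
  · have h1 := hu.mul_left_cancel ((mul_one _).trans (hR.trans (mul_assoc _ _ _)))
    rw [map_matLambdaInv] at h1
    rw [← evalR_transpose, ← Matrix.diagonal_transpose]
    congr 1
    refine left_inv_eq_right_inv h1.symm ?_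
    rw [Matrix.diagonal_mul_diagonal, ← Matrix.diagonal_one]
    simp [← headDiag_inv]

/-- As a polynomial in t the determinant is 1 at t = 0, hence nonzero. Its product with t(t - 1) has
only finitely many roots. -/
theorem exists_det_ne_zero (U L : Matrix (Fin n) (Fin n) ℂ) (hU : U.det = 1) :
    ∃ t : ℂ, t ≠ 0 ∧ t ≠ 1 ∧ (U - t • L).det ≠ 0 := by
  let P : Polynomial ℂ := (U.map Polynomial.C -
    (Polynomial.X : Polynomial ℂ) • L.map (Polynomial.C : ℂ →+* Polynomial ℂ)).det
  have hP : ∀ t, P.eval t = (U - t • L).det := by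
    intro t
    rw [← Polynomial.coe_evalRingHom, RingHom.map_det]
    congr 1
    ext i j
    simp
    ring
  have hP0 : P ≠ 0 := by
    intro h
    have := hP 0
    rw [h, zero_smul, sub_zero, hU, Polynomial.eval_zero] at this
    exact zero_ne_one this
  clear_value P
  obtain ⟨t, ht⟩ := Polynomial.exists_eval_ne_zero_of_natDegree_lt_card
    (P * (Polynomial.X * (Polynomial.X - Polynomial.C 1)))
    (mul_ne_zero hP0 (mul_ne_zero Polynomial.X_ne_zero (Polynomial.X_sub_C_ne_zero 1)))
    ((Cardinal.natCast_lt_aleph0).trans_le (Cardinal.aleph0_le_mk ℂ))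
  rw [Polynomial.eval_mul, Polynomial.eval_mul, Polynomial.eval_sub, Polynomial.eval_X,
    Polynomial.eval_C, hP] at ht
  have ht' := right_ne_zero_of_mul ht
  exact ⟨t, left_ne_zero_of_mul ht', sub_ne_zero.1 (right_ne_zero_of_mul ht'),
    left_ne_zero_of_mul ht⟩

/-- The homomorphism `R₀ → ℂ` with prescribed values of `λ` and `μ`. -/
noncomputable def evalLaurent (l t : ℂˣ) : R₀ →ₐ[ℤ] ℂ :=
  AddMonoidAlgebra.lift ℤ ℂ (ℤ × ℤ)
    { toFun := fun x => ((l ^ x.toAdd.1 * t ^ x.toAdd.2 : ℂˣ) : ℂ)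
      map_one' := by simp
      map_mul' := fun x y => by
        rw [← Units.val_mul, toAdd_mul, Prod.fst_add, Prod.snd_add, zpow_add, zpow_add,
          mul_mul_mul_comm] }

theorem evalLaurent_laurent (l t : ℂˣ) (a b : ℤ) :
    evalLaurent l t (laurent a b) = ((l ^ a * t ^ b : ℂˣ) : ℂ) := by
  rw [evalLaurent, laurent, AddMonoidAlgebra.lift_single, one_smul]
  rfl

theorem ar_eq_of_isDiagonal {β : BraidGroup n} {ε : CordAlg (Fin n) →ₐ[ℤ] ℂ} {c : ℂˣ}
    (h : IsDiagonal ε β (headDiag n c)) : ar β = n := by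
  obtain ⟨t, ht0, ht1, hdet⟩ := exists_det_ne_zero (upperMat ε) (lowerMat ε) (det_upperMat ε)
  let u : ℂˣ := Units.mk0 t ht0
  -- The value of λ is chosen so that λμ^ω becomes `c⁻¹`, which makes 𝚲 inverse to Φ^L.
  let f : R₀ →ₐ[ℤ] ℂ := evalLaurent (c⁻¹ * u ^ (-writhe β)) u
  let η : CordAlgR n →+* ℂ := (Algebra.TensorProduct.productMap ε f).toRingHom
  have hη : ∀ x r, η (x ⊗ₜ[ℤ] r) = ε x * f r :=
    Algebra.TensorProduct.productMap_apply_tmul ε f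
  have hf : ∀ a b, f (laurent a b) = (((c⁻¹ * u ^ (-writhe β)) ^ a * u ^ b : ℂˣ) : ℂ) :=
    evalLaurent_laurent _ _
  have hmu : f mu = t := by
    rw [mu, hf, zpow_zero, one_mul, zpow_one]
    rfl
  have hc : coeffHom η = ε := by
    ext x
    simp [coeffHom_apply, hη]
  have hl : laurentUnit η 1 (writhe β) = c⁻¹ := by
    ext
    change η (1 ⊗ₜ[ℤ] laurent 1 (writhe β)) = _
    rw [hη, map_one, one_mul, hf, zpow_one, mul_assoc, ← zpow_add, neg_add_cancel, zpow_zero,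
      mul_one]
  have hA : (matA n).map η = upperMat ε - t • lowerMat ε := by
    ext i j
    simp only [Matrix.map_apply, matA, upperMat, lowerMat, Matrix.of_apply, Matrix.sub_apply,
      Matrix.smul_apply, smul_eq_mul]
    rcases lt_trichotomy i j with h | h | h
    · simp [h, h.not_gt, h.ne, hη]
    · simp [h, hη, hmu]
    · simp [h, h.not_gt, h.ne', hη, hmu, mul_comm]
  have haug : IsAugmentation β η := by
    rw [isAugmentation_iff, hc, map_matLambda, map_matLambdaInv, hl, h.1, h.evalR, mul_assoc,
      mul_assoc, ← mul_assoc (Matrix.diagonal _)]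
    simp only [Matrix.diagonal_mul_diagonal, ← headDiag_inv, inv_inv, Units.inv_mul,
      Matrix.diagonal_one, one_mul, mul_one, and_self]
  refine le_antisymm ?_ ?_
  · refine csSup_le' ?_
    rintro r ⟨ε, -, -, rfl⟩
    simpa [augRank] using ((matA n).map ε).rank_le_width
  · refine le_csSup (bddAbove_augRanks β) ⟨η, haug, ?_, ?_⟩
    · rw [hη, map_one, one_mul, hmu]
      exact ht1
    · rw [augRank, hA, Matrix.rank_of_isUnit, Fintype.card_fin]
      rw [Matrix.isUnit_iff_isUnit_det]
      exact isUnit_iff_ne_zero.2 hdet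

end criterion

/-! ### Satellites -/

section satellite

variable {k p : ℕ} {K : Type*} [CommRing K]

theorem restrictHom_satelliteHom (hk : 0 < k) (c : CordAlg (Fin k) →ₐ[ℤ] K)
    (g : CordAlg (Fin p) →ₐ[ℤ] K) :
    restrictHom (Nat.le_mul_of_pos_left p hk) (satelliteHom c g) = g := by
  have he : ∀ r : Fin p, Fin.castLE (Nat.le_mul_of_pos_left p hk) r =
      finProdFinEquiv ((⟨0, hk⟩ : Fin k), r) := by
    intro r
    ext
    simp
  refine eq_of_lowerMat_eq_of_upperMat_eq ?_ ?_
  · ext r s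
    have h := congrFun (congrFun (lowerMat_satelliteHom c g) (finProdFinEquiv (⟨0, hk⟩, r)))
      (finProdFinEquiv (⟨0, hk⟩, s))
    rw [kronMat_apply, lowerMat_self, one_mul] at h
    rw [← h]
    simp [lowerMat, restrictHom_cord, he, finProdFinEquiv_lt]
  · ext r s
    have h := congrFun (congrFun (upperMat_satelliteHom c g) (finProdFinEquiv (⟨0, hk⟩, r)))
      (finProdFinEquiv (⟨0, hk⟩, s))
    rw [kronMat_apply, upperMat_eq c, Matrix.transpose_apply, lowerMat_self, one_mul] at h
    rw [← h]
    simp [upperMat, restrictHom_cord, he, finProdFinEquiv_lt]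

/-- After the parallel of α has acted, the homomorphism is still of Kronecker type with second
factor `g`. Its restriction to the first block is therefore `g`, and γ sees nothing of `c`. -/
theorem evalL_satelliteBraid (hk : 0 < k) (c : CordAlg (Fin k) →ₐ[ℤ] K)
    (g : CordAlg (Fin p) →ₐ[ℤ] K) (α : BraidGroup k) (γ : BraidGroup p) :
    evalL (satelliteHom c g) (satelliteBraid hk α γ) =
      extendOne (Nat.le_mul_of_pos_left p hk) (evalL g γ) * kronMat (evalL c α) 1 := by
  rw [satelliteBraid, isCocycle_evalL.mul, evalL_parallel, evalL_braidIncl, ← satelliteHom_act,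
    restrictHom_satelliteHom hk]

/-- The parallel contributes `u` on all of the first block; the factor `u⁻¹` contributed by γ
removes it, leaving `t` at the first strand alone. -/
theorem extendOne_mul_kronMat_headDiag (hk : 0 < k) (u t : Kˣ) :
    extendOne (Nat.le_mul_of_pos_left p hk)
      (Matrix.diagonal fun i : Fin p => ((u⁻¹ * headDiag p t i : Kˣ) : K)) *
      kronMat (Matrix.diagonal fun i => ((headDiag k u i : Kˣ) : K)) 1 =
      Matrix.diagonal fun i => ((headDiag (k * p) t i : Kˣ) : K) := by
  have hK : kronMat (p := p) (Matrix.diagonal fun i => ((headDiag k u i : Kˣ) : K)) 1 =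
      Matrix.diagonal fun x : Fin (k * p) => if (x : ℕ) < p then (u : K) else 1 := by
    refine matrix_ext_prod ?_
    rintro ⟨a, r⟩ ⟨b, s⟩
    have hr := r.2
    have hlt : (finProdFinEquiv (a, r) : ℕ) < p ↔ (a : ℕ) = 0 := by
      rw [finProdFinEquiv_apply_val]
      constructor
      · intro h
        by_contra h0
        have := Nat.mul_le_mul_left p (Nat.one_le_iff_ne_zero.2 h0)
        dsimp only at h
        omega
      · intro h
        simp [h]
    rw [kronMat_apply, Matrix.diagonal_apply, Matrix.diagonal_apply, Matrix.one_apply]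
    simp only [hlt, finProdFinEquiv.injective.eq_iff, Prod.mk.injEq, headDiag]
    by_cases h1 : a = b <;> by_cases h2 : r = s <;> by_cases h3 : (b : ℕ) = 0 <;>
      simp [h1, h2, h3]
  rw [extendOne_diagonal, hK, Matrix.diagonal_mul_diagonal]
  congr 1
  funext x
  by_cases h : (x : ℕ) < p
  · simp only [h, dif_pos, if_pos]
    rw [← Units.val_mul, mul_right_comm, inv_mul_cancel, one_mul]
    rfl
  · have h0 : (x : ℕ) ≠ 0 := by
      intro h0
      have := x.2
      rcases Nat.eq_zero_or_pos p with hp | hp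
      · simp [hp] at this
      · omega
    simp [h, h0, headDiag]

theorem isDiagonal_satelliteBraid (hk : 0 < k) {c : CordAlg (Fin k) →ₐ[ℤ] K}
    {g : CordAlg (Fin p) →ₐ[ℤ] K} {α : BraidGroup k} {γ : BraidGroup p} {u t : Kˣ}
    (hα : IsDiagonal c α (headDiag k u)) (hγ : IsDiagonal g γ fun i => u⁻¹ * headDiag p t i) :
    IsDiagonal (satelliteHom c g) (satelliteBraid hk α γ) (headDiag (k * p) t) := by
  refine ⟨?_, ?_⟩
  · rw [evalL_satelliteBraid hk, hα.1, hγ.1, extendOne_mul_kronMat_headDiag hk]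
  -- Φ^R is handled by the same computation for the flipped homomorphisms, with `u⁻¹` and `t⁻¹` in
  -- place of `u` and `t`.
  · rw [flip_satelliteHom, evalL_satelliteBraid hk, hα.2, hγ.2]
    simp only [mul_inv, headDiag_inv]
    exact extendOne_mul_kronMat_headDiag hk u⁻¹ t⁻¹

end satellite

end BraidSatellite

theorem mainTheorem1 {k p : ℕ} (α : BraidSatellite.BraidGroup k) (γ : BraidSatellite.BraidGroup p)
    (hα : BraidSatellite.ClosureIsKnot α) (hγ : BraidSatellite.ClosureIsKnot γ)
    (hαr : BraidSatellite.ar α = k) (hγr : BraidSatellite.ar γ = p) :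
    BraidSatellite.ar (BraidSatellite.satelliteBraid hα.1 α γ) = k * p := by
  obtain ⟨c, u, hc⟩ := BraidSatellite.exists_isDiagonal_of_ar_eq hα.1 hαr
  obtain ⟨g, v, hg⟩ := BraidSatellite.exists_isDiagonal_of_ar_eq hγ.1 hγr
  obtain ⟨s, hs⟩ := hg.exists_rescale hγ.1
    -- Rescaling preserves the product of the diagonal, which is `v`. The p factors `u⁻¹` must
    -- therefore be compensated by `u ^ p` in the head entry.
    (d' := fun i => u⁻¹ * BraidSatellite.headDiag p (u ^ p * v) i) hγ (by
      rw [Finset.prod_mul_distrib, BraidSatellite.prod_headDiag hγ.1,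
        BraidSatellite.prod_headDiag hγ.1, Finset.prod_const, Finset.card_univ, Fintype.card_fin,
        inv_pow, inv_mul_cancel_left])
  exact BraidSatellite.ar_eq_of_isDiagonal
    (BraidSatellite.isDiagonal_satelliteBraid hα.1 hc hs)
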